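/- Let $r\ge 2$ be an integer and let $0<\varepsilon<r$. There is a constant $c>0$, depending only on $r$ and $\varepsilon$, such that the following holds for all integers $t\ge 2$ and $n\ge t$. An instance of Unique Games over $\mathbb{Z}_r$ on a $t$-uniform hypergraph $H=(V,E)$ with $n$ vertices, where $E$ is a set of $t$-element subsets of $V$, consists of a linear constraint $\pi_e(x_e)=\big[\sum_{i\in e}a_{e,i}\,x_i=q_e\big]$ for each $e\in E$, with coefficients $a_{e,i}\in\mathbb{Z}_r^{\times}$ and $q_e\in\mathbb{Z}_r$. Its optimal value is $\operatorname{OPT}=\max_{x\in\mathbb{Z}_r^{V}}\sum_{e\in E}\pi_e(x_e)$. The hyperedges arrive one after the other in a stream, each with its constraint, in an arbitrary (adversarial) order. A classical randomized streaming algorithm with $s$ bits of space reads the stream once and keeps a memory in $\{0,1\}^s$; each update of the memory depends on the current memory, the arriving constraint, the number of constraints read so far and the algorithm's internal randomness, and the output, a real number, depends on the final memory and the internal randomness. If such an algorithm gives an $(r-\varepsilon)$-approximation with success probability at least $2/3$, that is, if on every such instance and for every order of its hyperedges its output lies in $[\operatorname{OPT}/(r-\varepsilon),\operatorname{OPT}]$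 with probability at least $2/3$ over its internal randomness, then $$ s\;\ge\; c\,\Big(\frac{n}{t}\Big)^{1-1/t}. $$ (In particular this holds for every algorithm that is correct on all hypergraphs with hyperedges of size at most $t$, on hypergraphs with repeated hyperedges, or for a larger class of linear constraints.) -/

import Mathlib

open MeasureTheory

/-- A linear Unique Games constraint over `ℤ/r` on a hyperedge with `t` vertices among the
`n` vertices `Fin n`: the equation `∑ i ∈ edge, a i * x i = q` in `ℤ/r`. As in Unique Games, the
value at each vertex of the hyperedge is determined by the values at the other ones, that is, the
coefficients `a i` are units. -/
structure UGConstraint (r t n : ℕ) where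
  edge : Finset (Fin n)
  card_edge : edge.card = t
  coeff : edge → (ZMod r)ˣ
  rhs : ZMod r

namespace UGConstraint

variable {r t n : ℕ}

/-- The assignment `x` satisfies the constraint, that is, `π_e(x_e) = 1`. -/
def Satisfies (C : UGConstraint r t n) (x : Fin n → ZMod r) : Prop :=
  ∑ i : C.edge, (C.coeff i : ZMod r) * x i = C.rhs

instance (C : UGConstraint r t n) (x : Fin n → ZMod r) : Decidable (C.Satisfies x) :=
  inferInstanceAs (Decidable (_ = _))

end UGConstraint

/-- A Unique Games instance on a `t`-uniform hypergraph with vertex set `Fin n`, presented as a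
stream: the constraints are listed one after the other, in an arbitrary order. -/
abbrev UGStream (r t n : ℕ) := List (UGConstraint r t n)

namespace UGStream

variable {r t n : ℕ}

/-- The hyperedges form a set: each one occurs once in the stream, with one constraint. -/
def IsSimple (L : UGStream r t n) : Prop := (L.map UGConstraint.edge).Nodup

/-- The number of constraints that the assignment `x` satisfies. -/
def value (L : UGStream r t n) (x : Fin n → ZMod r) : ℕ :=
  L.countP fun C => decide (C.Satisfies x)

/-- The optimal value of the instance: the maximum, over all assignments, of the number of
satisfied constraints. -/
noncomputable def opt (L : UGStream r t n) : ℕ := ⨆ x : Fin n → ZMod r, L.value x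

theorem bddAbove_value (L : UGStream r t n) : BddAbove (Set.range L.value) :=
  ⟨L.length, by rintro _ ⟨x, rfl⟩; exact List.countP_le_length⟩

/-- The supremum in `opt` is a maximum. -/
theorem isGreatest_opt (L : UGStream r t n) : IsGreatest (Set.range L.value) L.opt :=
  ⟨Nat.sSup_mem (Set.range_nonempty _) L.bddAbove_value,
    fun _ h => le_csSup L.bddAbove_value h⟩

end UGStream

/-- A classical randomized one-pass streaming algorithm with `s` bits of memory, which reads a
stream of elements of `α`. The internal randomness is a random point `ω` of `Ω`, and it may be
consulted at any time without being stored in the memory. The `i`-th update may depend on `i`, so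
that, in particular, fresh random bits may be used for each update. There is no restriction on the
way in which the updates and the output are computed. -/
structure StreamingAlgorithm (Ω : Type*) [MeasurableSpace Ω] (α : Type*) (s : ℕ) where
  init : Ω → (Fin s → Bool)
  step : Ω → ℕ → (Fin s → Bool) → α → (Fin s → Bool)
  out : Ω → (Fin s → Bool) → ℝ
  measurable_init : Measurable init
  measurable_step : ∀ i m a, Measurable fun ω => step ω i m a
  measurable_out : ∀ m, Measurable fun ω => out ω m

namespace StreamingAlgorithm

variable {Ω : Type*} [MeasurableSpace Ω] {α : Type*} {s : ℕ}

/-- The memory after reading the list, when its first element is the `i`-th element of the stream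
and the memory is `m` before it is read. -/
def runFrom (A : StreamingAlgorithm Ω α s) (ω : Ω) :
    ℕ → (Fin s → Bool) → List α → (Fin s → Bool)
  | _, m, [] => m
  | i, m, a :: L => A.runFrom ω (i + 1) (A.step ω i m a) L

/-- The output on the stream `L`: it is computed from the memory after the last update. -/
def output (A : StreamingAlgorithm Ω α s) (ω : Ω) (L : List α) : ℝ :=
  A.out ω (A.runFrom ω 0 (A.init ω) L)

/-- The algorithm gives a `γ`-approximation for Unique Games on `t`-uniform hypergraphs with
vertex set `Fin n` over `ℤ/r`, with success probability at least `p`: on every instance, whatever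
the order in which it is presented, the output lies in `[OPT / γ, OPT]` with probability at least
`p` over the internal randomness. -/
def ApproximatesUG {r t n : ℕ} (A : StreamingAlgorithm Ω (UGConstraint r t n) s)
    (μ : Measure Ω) (γ p : ℝ) : Prop :=
  ∀ L : UGStream r t n, L.IsSimple →
    p ≤ μ.real {ω | A.output ω L ∈ Set.Icc ((L.opt : ℝ) / γ) (L.opt : ℝ)}

end StreamingAlgorithm

/-! The hard instances use only coefficients 1. Put `T = C * n`, take `T` distinct random `t`-sets,
and label each of them either by the sum of a hidden uniform `x` over it or by an independent
uniform element. In the first case OPT is `T`; in the second, a Chernoff and union bound over all `r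
^ n` assignments puts OPT below `T / (r - ε)` with probability at least 9/10. A good algorithm
therefore tells the two cases apart.

The memory splits the cube of all `x` into at most `2 ^ s` fibres. By Fourier analysis, what a fibre
reveals about the sum over `e`, in the `χ²` sense, is its Fourier mass at the frequencies `j • 1_e`
with `j ≠ 0`. A hypercontractive inequality bounds the total mass over all `t`-sets, and
`sum_leakage_edgeSum_le` turns this into a total leakage of at most `(4 * r / δ) ^ t * 2 ^ (2 * δ *
s)`. The next hyperedge is uniform among the unread ones, at least half of all `t`-sets, so one step
leaks on average at most twice that total divided by `n.choose t` (`sum_perm_apply_le`).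

Passing from uniform labels to true labels one step at a time would lose a square root of the
leakage at each step. `average_sub_le_of_martingale` avoids this: the acceptance probability is a
bounded martingale under uniform labels, so its quadratic variation is under control and the loss is
linear in the total leakage, plus a small constant.

With `δ = t / (s + t)` the memory factor is at most `4 ^ t`, and since `n.choose t ≥ (n / t) ^ t`
the comparison becomes `n ^ t ≤ n * (D * (s + t)) ^ t`, which is the claimed bound. -/

/-- For `y > 0`, `y ^ δ ≥ 1 + δ * log y`, so a lower bound on `y * log y` is enough. With `q = √y`
and `log q ≥ 1 - 1 / q`, one gets `y * log y ≥ (y - 1) + (q - 1) ^ 2`, and `y - 1 = (q - 1) * (q +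
1)` where `(q + 1) ^ 2 ≤ 4 * r`. The quadratic gain is what pays for the noise parameter `ρ`. -/
theorem add_mul_sq_le_rpow {r δ y : ℝ} (hr : 1 ≤ r) (hδ : 0 ≤ δ) (hy : 0 ≤ y) (hyr : y ≤ r) :
    y + δ * ((y - 1) + (y - 1) ^ 2 / (4 * r)) ≤ y ^ (1 + δ) := by
  rcases hy.eq_or_lt with rfl | hy
  · have h1 : (0 - 1 : ℝ) ^ 2 / (4 * r) ≤ 1 := by
      rw [div_le_one (by positivity)]; linarith
    have h2 : (0 : ℝ) ≤ 0 ^ (1 + δ) := Real.rpow_nonneg le_rfl _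
    nlinarith
  · have h1 : 1 + δ * Real.log y ≤ y ^ δ := by
      rw [Real.rpow_def_of_pos hy]
      have := Real.add_one_le_exp (Real.log y * δ)
      linarith
    have h2 : (y - 1) + (y - 1) ^ 2 / (4 * r) ≤ y * Real.log y := by
      have hq : 0 < √y := Real.sqrt_pos.2 hy
      have hl : Real.log y = 2 * Real.log (√y) := by rw [Real.log_sqrt hy.le]; ring
      have hq2 : y = √y ^ 2 := (Real.sq_sqrt hy.le).symm
      have h3 := Real.one_sub_inv_le_log_of_pos hq
      set q := √y
      have h4 : (y - 1) ^ 2 / (4 * r) ≤ (q - 1) ^ 2 := by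
        rw [div_le_iff₀ (by positivity)]
        have : (q + 1) ^ 2 ≤ 4 * r := by nlinarith [sq_nonneg (q - 1)]
        have := mul_le_mul_of_nonneg_left this (sq_nonneg (q - 1))
        rw [hq2]; nlinarith
      have h5 : 2 * q ^ 2 - 2 * q ≤ y * Real.log y := by
        rw [hl]
        have := mul_le_mul_of_nonneg_left h3 (by positivity : 0 ≤ 2 * q ^ 2)
        have h6 : 2 * q ^ 2 * (1 - q⁻¹) = 2 * q ^ 2 - 2 * q := by field_simp
        rw [hq2] at *
        nlinarith
      nlinarith
    have h3 : y ^ (1 + δ) = y * y ^ δ := by rw [Real.rpow_add hy, Real.rpow_one]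
    rw [h3]
    have h4 := mul_le_mul_of_nonneg_left h1 hy.le
    have h5 := mul_le_mul_of_nonneg_left h2 hδ
    nlinarith

/-! ### Hypercontractivity of the noise operator on a finite product space -/

section Hypercontractivity

variable {κ : Type*} [Fintype κ] [Nonempty κ]

/-- Scale `u` to mean 1, so that its values lie in `[0, r]`, and sum the scalar inequality over the
points: the linear terms cancel and `δ / (4 * r) = ρ` multiplies the variance. -/
theorem noise_quadratic_le {δ ρ : ℝ} (hδ : 0 ≤ δ) (hδ1 : δ ≤ 1)
    (hρ : ρ = δ / (4 * Fintype.card κ)) (u : κ → ℝ) (hu : ∀ a, 0 ≤ u a) :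
    (1 - ρ) * (∑ a, u a) ^ 2 + ρ * Fintype.card κ * ∑ a, u a ^ 2 ≤
      (Fintype.card κ : ℝ) ^ (2 - 2 / (1 + δ)) * (∑ a, u a ^ (1 + δ)) ^ (2 / (1 + δ)) := by
  set r : ℝ := (Fintype.card κ : ℝ) with hr
  have hr1 : (1 : ℝ) ≤ r := by
    rw [hr]; exact_mod_cast Fintype.card_pos
  have hr0 : 0 < r := by linarith
  have hp : 0 < 1 + δ := by linarith
  set S := ∑ a, u a with hS
  have hS0 : 0 ≤ S := Finset.sum_nonneg fun a _ => hu a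
  have hRHS : 0 ≤ ∑ a, u a ^ (1 + δ) := Finset.sum_nonneg fun a _ => Real.rpow_nonneg (hu a) _
  rcases hS0.eq_or_lt with h0 | hSpos
  · have : ∀ a, u a = 0 := fun a =>
      (Finset.sum_eq_zero_iff_of_nonneg fun a _ => hu a).1 h0.symm a (Finset.mem_univ a)
    have h1 : ∑ a, u a ^ 2 = 0 := Finset.sum_eq_zero fun a _ => by simp [this a]
    rw [← h0, h1]; simp only [ne_eq, OfNat.ofNat_ne_zero, not_false_eq_true, zero_pow, mul_zero,
      add_zero]
    positivity
  · have hρ0 : 0 ≤ ρ := by rw [hρ]; positivity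
    have hule : ∀ a, r * u a / S ≤ r := fun a => by
      rw [div_le_iff₀ hSpos]
      exact mul_le_mul_of_nonneg_left
        (Finset.single_le_sum (fun a _ => hu a) (Finset.mem_univ a)) hr0.le
    have hpt : ∀ a, r * u a / S + δ * ((r * u a / S - 1) + (r * u a / S - 1) ^ 2 / (4 * r)) ≤
        (r / S) ^ (1 + δ) * u a ^ (1 + δ) := fun a => by
      rw [← Real.mul_rpow (by positivity) (hu a)]
      have := add_mul_sq_le_rpow hr1 hδ (div_nonneg (mul_nonneg hr0.le (hu a)) hS0) (hule a)
      convert this using 2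
      ring
    have hsum := Finset.sum_le_sum fun a (_ : a ∈ Finset.univ) => hpt a
    rw [← Finset.mul_sum] at hsum
    have hU : ∑ a, r * u a / S = r := by
      rw [← Finset.sum_div, ← Finset.mul_sum, ← hS]; field_simp
    have hc : ∑ _a : κ, (1 : ℝ) = r := by simp [hr]
    have hL : ∑ a, (r * u a / S + δ * ((r * u a / S - 1) + (r * u a / S - 1) ^ 2 / (4 * r))) =
        r * ((1 - ρ) + ρ * r * (∑ a, u a ^ 2) / S ^ 2) := by
      have : ∀ a, (r * u a / S + δ * ((r * u a / S - 1) + (r * u a / S - 1) ^ 2 / (4 * r))) =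
          (1 + δ - 2 * ρ) * (r * u a / S) + (ρ - δ) * 1 + ρ * r ^ 2 / S ^ 2 * u a ^ 2 := by
        intro a; rw [hρ]; field_simp; ring
      simp_rw [this]
      rw [Finset.sum_add_distrib, Finset.sum_add_distrib, ← Finset.mul_sum, ← Finset.mul_sum,
        ← Finset.mul_sum, hU, hc]
      field_simp; ring
    rw [hL] at hsum
    set P := ∑ a, u a ^ (1 + δ)
    set W := (1 - ρ) + ρ * r * (∑ a, u a ^ 2) / S ^ 2 with hW
    -- This allows the exponent of `W` to be raised from 1 to `2 / (1 + δ)`, which matches the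
    -- norms.
    have hW1 : 1 ≤ W := by
      have hcs : S ^ 2 ≤ r * ∑ a, u a ^ 2 := by
        have := sq_sum_le_card_mul_sum_sq (s := (Finset.univ : Finset κ)) (f := u)
        simpa [hr] using this
      have : 1 ≤ r * (∑ a, u a ^ 2) / S ^ 2 := by
        rw [le_div_iff₀ (by positivity)]; linarith
      have h2 : ρ * r * (∑ a, u a ^ 2) / S ^ 2 = ρ * (r * (∑ a, u a ^ 2) / S ^ 2) := by ring
      rw [hW, h2]; nlinarith
    have hWle : W ≤ r⁻¹ * ((r / S) ^ (1 + δ) * P) := by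
      rw [inv_mul_eq_div, le_div_iff₀ hr0]; linarith
    have he : 1 ≤ 2 / (1 + δ) := by rw [le_div_iff₀ hp]; linarith
    have h3 : W ≤ (r⁻¹ * ((r / S) ^ (1 + δ) * P)) ^ (2 / (1 + δ)) :=
      calc W = W ^ (1 : ℝ) := (Real.rpow_one _).symm
        _ ≤ W ^ (2 / (1 + δ)) := Real.rpow_le_rpow_of_exponent_le hW1 he
        _ ≤ _ := Real.rpow_le_rpow (by linarith) hWle (by positivity)
    rw [Real.mul_rpow (by positivity) (by positivity), Real.mul_rpow (by positivity) hRHS,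
      ← Real.rpow_mul (by positivity), mul_div_cancel₀ _ hp.ne'] at h3
    have h4 : r ^ (2 - 2 / (1 + δ)) = r ^ 2 * r⁻¹ ^ (2 / (1 + δ)) := by
      rw [Real.rpow_sub hr0, Real.inv_rpow hr0.le, div_eq_mul_inv, Real.rpow_two]
    have h5 : (1 - ρ) * S ^ 2 + ρ * r * ∑ a, u a ^ 2 = S ^ 2 * W := by
      rw [hW]; field_simp
    rw [h5, h4]
    refine (mul_le_mul_of_nonneg_left h3 (by positivity)).trans (le_of_eq ?_)
    rw [Real.rpow_two, div_pow]; field_simp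

/-- Cauchy–Schwarz for the positive semidefinite noise form reduces this to the quadratic case. The
two-function version is what the induction on the number of coordinates needs. -/
theorem noise_bilinear_le [DecidableEq κ] {δ ρ : ℝ} (hδ : 0 ≤ δ) (hδ1 : δ ≤ 1)
    (hρ : ρ = δ / (4 * Fintype.card κ)) (u v : κ → ℝ) (hu : ∀ a, 0 ≤ u a) (hv : ∀ a, 0 ≤ v a) :
    ∑ a, ∑ b, (1 - ρ + if a = b then ρ * Fintype.card κ else 0) * (u a * v b) ≤
      (Fintype.card κ : ℝ) ^ (2 - 2 / (1 + δ)) *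
        ((∑ a, u a ^ (1 + δ)) ^ (1 / (1 + δ)) * (∑ a, v a ^ (1 + δ)) ^ (1 / (1 + δ))) := by
  have hr1 : (1 : ℝ) ≤ Fintype.card κ := by exact_mod_cast Fintype.card_pos
  have h1 := noise_quadratic_le hδ hδ1 hρ u hu
  have h2 := noise_quadratic_le hδ hδ1 hρ v hv
  have hP : 0 ≤ ∑ a, u a ^ (1 + δ) := Finset.sum_nonneg fun a _ => Real.rpow_nonneg (hu a) _
  have hP' : 0 ≤ ∑ a, v a ^ (1 + δ) := Finset.sum_nonneg fun a _ => Real.rpow_nonneg (hv a) _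
  have hsq : ∀ {z : ℝ}, 0 ≤ z → z ^ (2 / (1 + δ)) = (z ^ (1 / (1 + δ))) ^ 2 := fun {z} hz => by
    rw [← Real.rpow_natCast, ← Real.rpow_mul hz]; congr 1; push_cast; ring
  rw [hsq hP] at h1
  rw [hsq hP'] at h2
  have hL : ∑ a, ∑ b, (1 - ρ + if a = b then ρ * Fintype.card κ else 0) * (u a * v b) =
      (1 - ρ) * ((∑ a, u a) * ∑ a, v a) + ρ * Fintype.card κ * ∑ a, u a * v a := by
    simp_rw [add_mul, Finset.sum_add_distrib, ite_mul, zero_mul, Finset.sum_ite_eq,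
      Finset.mem_univ, if_true, Finset.sum_mul_sum, Finset.mul_sum]
  rw [hL]
  have hρ0 : 0 ≤ ρ := by rw [hρ]; positivity
  have hρ1 : ρ ≤ 1 := by
    rw [hρ, div_le_one (by positivity)]; linarith
  set r : ℝ := (Fintype.card κ : ℝ)
  set a1 := ∑ a, u a
  set a2 := ∑ a, v a
  set b1 := ∑ a, u a ^ 2
  set b2 := ∑ a, v a ^ 2
  set x := (∑ a, u a ^ (1 + δ)) ^ (1 / (1 + δ))
  set y := (∑ a, v a ^ (1 + δ)) ^ (1 / (1 + δ))
  have hx : 0 ≤ x := Real.rpow_nonneg hP _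
  have hy : 0 ≤ y := Real.rpow_nonneg hP' _
  have hc : 0 ≤ r ^ (2 - 2 / (1 + δ)) := by positivity
  set c := r ^ (2 - 2 / (1 + δ))
  have hcs : (∑ a, u a * v a) ^ 2 ≤ b1 * b2 := Finset.sum_mul_sq_le_sq_mul_sq _ _ _
  set d := ∑ a, u a * v a
  have hb1 : 0 ≤ b1 := Finset.sum_nonneg fun _ _ => sq_nonneg _
  have hb2 : 0 ≤ b2 := Finset.sum_nonneg fun _ _ => sq_nonneg _
  refine (le_abs_self _).trans (abs_le_of_sq_le_sq ?_ (by positivity))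
  have hρr : 0 ≤ ρ * r := by positivity
  have key : ((1 - ρ) * (a1 * a2) + ρ * r * d) ^ 2 ≤
      ((1 - ρ) * a1 ^ 2 + ρ * r * b1) * ((1 - ρ) * a2 ^ 2 + ρ * r * b2) := by
    have h3 : 2 * (a1 * a2) * d ≤ a1 ^ 2 * b2 + a2 ^ 2 * b1 := by
      have e1 := Finset.sum_nonneg fun a (_ : a ∈ (Finset.univ : Finset κ)) =>
        sq_nonneg (a1 * v a - a2 * u a)
      have e2 : ∑ a, (a1 * v a - a2 * u a) ^ 2 = a1 ^ 2 * b2 + a2 ^ 2 * b1 - 2 * (a1 * a2) * d := by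
        simp_rw [b1, b2, d, Finset.mul_sum, ← Finset.sum_add_distrib, ← Finset.sum_sub_distrib]
        exact Finset.sum_congr rfl fun _ _ => by ring
      linarith
    have e1 := mul_le_mul_of_nonneg_left h3 (mul_nonneg (sub_nonneg.2 hρ1) hρr)
    have e2 := mul_le_mul_of_nonneg_left hcs (mul_nonneg hρr hρr)
    nlinarith
  calc _ ≤ _ := key
    _ ≤ (c * x ^ 2) * (c * y ^ 2) := mul_le_mul h1 h2 (by
        have := sub_nonneg.2 hρ1; positivity) (by positivity)
    _ = _ := by ring

/-- Tensorization: fix the first coordinates `a` and `b`, apply the induction hypothesis to the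
slices, then apply the one-coordinate inequality to the slice norms `F a` and `G b`. -/
theorem noise_tensor_le [DecidableEq κ] {δ ρ : ℝ} (hδ : 0 ≤ δ) (hδ1 : δ ≤ 1)
    (hρ : ρ = δ / (4 * Fintype.card κ)) (n : ℕ) (f g : (Fin n → κ) → ℝ) (hf : ∀ x, 0 ≤ f x)
    (hg : ∀ x, 0 ≤ g x) :
    ∑ x, ∑ y, (∏ i, (1 - ρ + if x i = y i then ρ * Fintype.card κ else 0)) * (f x * g y) ≤
      ((Fintype.card κ : ℝ) ^ (2 - 2 / (1 + δ))) ^ n *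
        ((∑ x, f x ^ (1 + δ)) ^ (1 / (1 + δ)) * (∑ x, g x ^ (1 + δ)) ^ (1 / (1 + δ))) := by
  have hp : 1 + δ ≠ 0 := by linarith
  have hr1 : (1 : ℝ) ≤ Fintype.card κ := by exact_mod_cast Fintype.card_pos
  have hρ0 : 0 ≤ ρ := by rw [hρ]; positivity
  have hρ1 : ρ ≤ 1 := by
    rw [hρ, div_le_one (by positivity)]; linarith
  induction n with
  | zero =>
    simp [← Real.rpow_mul, hf, hg, mul_inv_cancel₀ hp]
  | succ n ih =>
    have hsum : ∀ F : (Fin (n + 1) → κ) → ℝ,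
        ∑ x, F x = ∑ a, ∑ x : Fin n → κ, F (Fin.cons a x) := fun F => by
      rw [← (Fin.consEquiv fun _ => κ).sum_comp, Fintype.sum_prod_type]; rfl
    have hk : ∀ a b : κ, 0 ≤ 1 - ρ + if a = b then ρ * Fintype.card κ else 0 := fun a b => by
      have := sub_nonneg.2 hρ1
      split_ifs <;> positivity
    set c : ℝ := (Fintype.card κ : ℝ) ^ (2 - 2 / (1 + δ)) with hc
    have hc0 : 0 ≤ c := by positivity
    set F : κ → ℝ := fun a => (∑ x : Fin n → κ, f (Fin.cons a x) ^ (1 + δ)) ^ (1 / (1 + δ)) with hF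
    set G : κ → ℝ := fun a => (∑ x : Fin n → κ, g (Fin.cons a x) ^ (1 + δ)) ^ (1 / (1 + δ)) with hG
    have hnn : ∀ (h : (Fin (n + 1) → κ) → ℝ) (_ : ∀ x, 0 ≤ h x) (a : κ),
        0 ≤ ∑ x : Fin n → κ, h (Fin.cons a x) ^ (1 + δ) := fun h hh a =>
      Finset.sum_nonneg fun x _ => Real.rpow_nonneg (hh _) _
    have hpow : ∀ {z : ℝ}, 0 ≤ z → (z ^ (1 / (1 + δ))) ^ (1 + δ) = z := fun {z} hz => by
      rw [← Real.rpow_mul hz, one_div_mul_cancel hp, Real.rpow_one]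
    have hone := noise_bilinear_le hδ hδ1 hρ F G (fun a => Real.rpow_nonneg (hnn f hf a) _)
      (fun a => Real.rpow_nonneg (hnn g hg a) _)
    simp_rw [hF, hG, hpow (hnn f hf _), hpow (hnn g hg _)] at hone
    rw [← hsum (fun x => f x ^ (1 + δ)), ← hsum (fun x => g x ^ (1 + δ))] at hone
    calc _ = ∑ a, ∑ b, (1 - ρ + if a = b then ρ * Fintype.card κ else 0) *
          ∑ x : Fin n → κ, ∑ y : Fin n → κ,
            (∏ i, (1 - ρ + if x i = y i then ρ * Fintype.card κ else 0)) *
              (f (Fin.cons a x) * g (Fin.cons b y)) := by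
          rw [hsum]
          refine Finset.sum_congr rfl fun a _ => ?_
          simp_rw [hsum (fun y => _ * (_ * g y)), Finset.mul_sum]
          rw [Finset.sum_comm]
          refine Finset.sum_congr rfl fun b _ => Finset.sum_congr rfl fun x _ =>
            Finset.sum_congr rfl fun y _ => ?_
          rw [Fin.prod_univ_succ]
          simp only [Fin.cons_zero, Fin.cons_succ]
          ring
      _ ≤ ∑ a, ∑ b, (1 - ρ + if a = b then ρ * Fintype.card κ else 0) *
          (c ^ n * (F a * G b)) := by
          refine Finset.sum_le_sum fun a _ => Finset.sum_le_sum fun b _ =>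
            mul_le_mul_of_nonneg_left ?_ (hk a b)
          exact ih _ _ (fun _ => hf _) (fun _ => hg _)
      _ = c ^ n * ∑ a, ∑ b, (1 - ρ + if a = b then ρ * Fintype.card κ else 0) * (F a * G b) := by
          simp_rw [Finset.mul_sum]
          exact Finset.sum_congr rfl fun a _ => Finset.sum_congr rfl fun b _ => by ring
      _ ≤ c ^ n * _ := mul_le_mul_of_nonneg_left hone (by positivity)
      _ = _ := by ring

theorem noise_finset_le [DecidableEq κ] {δ ρ : ℝ} (hδ : 0 ≤ δ) (hδ1 : δ ≤ 1)
    (hρ : ρ = δ / (4 * Fintype.card κ)) {n : ℕ} (A : Finset (Fin n → κ)) :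
    ∑ x ∈ A, ∑ y ∈ A, ∏ i, (1 - ρ + if x i = y i then ρ * Fintype.card κ else 0) ≤
      ((Fintype.card κ : ℝ) ^ (2 - 2 / (1 + δ))) ^ n * (A.card : ℝ) ^ (2 / (1 + δ)) := by
  classical
  have hp : 1 + δ ≠ 0 := by linarith
  have h := noise_tensor_le hδ hδ1 hρ n (fun x => if x ∈ A then 1 else 0)
    (fun x => if x ∈ A then 1 else 0) (fun x => by positivity) (fun x => by positivity)
  have h1 : ∑ x : Fin n → κ, (if x ∈ A then (1 : ℝ) else 0) ^ (1 + δ) = A.card := by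
    simp [Real.zero_rpow hp, apply_ite (fun z : ℝ => z ^ (1 + δ))]
  rw [h1, ← Real.rpow_add_of_nonneg (by positivity) (by positivity) (by positivity)] at h
  have h2 : 1 / (1 + δ) + 1 / (1 + δ) = 2 / (1 + δ) := by ring
  rw [h2] at h
  refine le_trans (le_of_eq ?_) h
  simp [mul_ite]

end Hypercontractivity

/-- The number of pairs in `A` with the same label, times `r`, minus the number of all pairs. -/
noncomputable def labelExcess {r : ℕ} [NeZero r] {X : Type*} (A : Finset X) (lab : X → ZMod r) :
    ℝ :=
  r * ∑ b, ((A.filter fun x => lab x = b).card : ℝ) ^ 2 - (A.card : ℝ) ^ 2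

/-- The sum of the coordinates of `x` in `e`. -/
def edgeSum {r n : ℕ} (e : Finset (Fin n)) (x : Fin n → ZMod r) : ZMod r := ∑ i ∈ e, x i

/-! ### Fourier expansion of the label excess and of the noise form -/

section Fourier

variable {r : ℕ} [NeZero r]

theorem normSq_sum_stdAddChar {X : Type*} (A : Finset X) (φ : X → ZMod r) :
    ((Complex.normSq (∑ x ∈ A, ZMod.stdAddChar (φ x)) : ℝ) : ℂ) =
      ∑ x ∈ A, ∑ y ∈ A, ZMod.stdAddChar (φ x - φ y) := by
  rw [← Complex.mul_conj, map_sum, Finset.sum_mul_sum]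
  refine Finset.sum_congr rfl fun x _ => Finset.sum_congr rfl fun y _ => ?_
  rw [sub_eq_add_neg, AddChar.map_add_eq_mul, AddChar.map_neg_eq_conj]

theorem stdAddChar_sum {ι : Type*} (s : Finset ι) (φ : ι → ZMod r) :
    ZMod.stdAddChar (∑ i ∈ s, φ i) = ∏ i ∈ s, ZMod.stdAddChar (φ i) := by
  classical
  induction s using Finset.induction_on with
  | empty => simp
  | insert i s hi ih => rw [Finset.sum_insert hi, Finset.prod_insert hi, AddChar.map_add_eq_mul, ih]

theorem sum_stdAddChar_mul (c : ZMod r) :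
    ∑ j : ZMod r, ZMod.stdAddChar (j * c) = if c = 0 then (r : ℂ) else 0 := by
  rw [AddChar.sum_mulShift c (ZMod.isPrimitive_stdAddChar r), ZMod.card]
  split_ifs <;> simp

/-- Parseval on `ZMod r` for the counts of the labels; the subtracted square is the term `j = 0`. -/
theorem labelExcess_eq {X : Type*} (A : Finset X) (lab : X → ZMod r) :
    labelExcess A lab = ∑ j ∈ Finset.univ.erase (0 : ZMod r),
      Complex.normSq (∑ x ∈ A, ZMod.stdAddChar (j * lab x)) := by
  have h : ∑ j : ZMod r, Complex.normSq (∑ x ∈ A, ZMod.stdAddChar (j * lab x)) =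
      r * ∑ b, ((A.filter fun x => lab x = b).card : ℝ) ^ 2 := by
    apply Complex.ofReal_injective
    push_cast
    simp_rw [normSq_sum_stdAddChar, ← mul_sub]
    have h1 : ∀ b : ZMod r, ((A.filter fun x => lab x = b).card : ℂ) ^ 2 =
        ∑ x ∈ A, ∑ y ∈ A, if lab x = b ∧ lab y = b then 1 else 0 := fun b => by
      rw [sq, Finset.card_filter]
      push_cast
      rw [Finset.sum_mul_sum]
      refine Finset.sum_congr rfl fun x _ => Finset.sum_congr rfl fun y _ => ?_
      split_ifs <;> simp_all
    simp_rw [h1]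
    rw [Finset.sum_comm, Finset.sum_comm (s := Finset.univ), Finset.mul_sum]
    refine Finset.sum_congr rfl fun x _ => ?_
    rw [Finset.sum_comm, Finset.sum_comm (s := Finset.univ), Finset.mul_sum]
    refine Finset.sum_congr rfl fun y _ => ?_
    rw [sum_stdAddChar_mul]
    simp_rw [ite_and]
    rw [Finset.sum_ite_eq]
    simp [sub_eq_zero, eq_comm]
  rw [labelExcess, ← h, ← Finset.add_sum_erase _ _ (Finset.mem_univ (0 : ZMod r))]
  have h0 : Complex.normSq (∑ x ∈ A, ZMod.stdAddChar (0 * lab x)) = (A.card : ℝ) ^ 2 := by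
    simp [sq]
  rw [h0]; ring

theorem labelExcess_nonneg {X : Type*} (A : Finset X) (lab : X → ZMod r) :
    0 ≤ labelExcess A lab := by
  rw [labelExcess_eq]
  exact Finset.sum_nonneg fun _ _ => Complex.normSq_nonneg _

theorem sum_noise_eq (ρ : ℝ) {n : ℕ} (A : Finset (Fin n → ZMod r)) :
    ∑ x ∈ A, ∑ y ∈ A, ∏ i, (1 - ρ + if x i = y i then ρ * Fintype.card (ZMod r) else 0) =
      ∑ k : Fin n → ZMod r, (∏ i, if k i = 0 then 1 else ρ) *
        Complex.normSq (∑ x ∈ A, ZMod.stdAddChar (∑ i, k i * x i)) := by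
  apply Complex.ofReal_injective
  push_cast
  simp_rw [normSq_sum_stdAddChar, Finset.mul_sum]
  refine Eq.trans ?_ Finset.sum_comm
  refine Finset.sum_congr rfl fun x _ => ?_
  refine Eq.trans ?_ Finset.sum_comm
  refine Finset.sum_congr rfl fun y _ => ?_
  -- In one coordinate the kernel has Fourier coefficient 1 at the trivial character and `ρ` at
  -- every other one.
  have h1 : ∀ c : ZMod r, (1 - (ρ : ℂ) + if c = 0 then (ρ : ℂ) * r else 0) =
      ∑ k : ZMod r, (if k = 0 then 1 else (ρ : ℂ)) * ZMod.stdAddChar (k * c) := fun c => by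
    have h2 : ∀ k : ZMod r, (if k = 0 then 1 else (ρ : ℂ)) * ZMod.stdAddChar (k * c) =
        ρ * ZMod.stdAddChar (k * c) + if k = 0 then 1 - (ρ : ℂ) else 0 := fun k => by
      split_ifs with h
      · simp [h]
      · simp
    simp_rw [h2, Finset.sum_add_distrib, ← Finset.mul_sum, sum_stdAddChar_mul,
      Finset.sum_ite_eq', Finset.mem_univ, if_true]
    split_ifs <;> ring
  have h3 : ∀ i, (1 - (ρ : ℂ) + ((if x i = y i then ρ * Fintype.card (ZMod r) else 0 : ℝ) : ℂ)) =
      ∑ k : ZMod r, (if k = 0 then 1 else (ρ : ℂ)) * ZMod.stdAddChar (k * (x i - y i)) :=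
    fun i => by
      rw [← h1, ZMod.card]
      simp only [sub_eq_zero]
      split_ifs <;> simp
  simp_rw [h3, Fintype.prod_sum, Finset.prod_mul_distrib]
  refine Finset.sum_congr rfl fun k _ => ?_
  rw [← stdAddChar_sum, ← Finset.sum_sub_distrib]
  congr 1
  · refine Finset.prod_congr rfl fun i _ => ?_
    split_ifs <;> simp
  · simp_rw [mul_sub]

/-- The pairs `(e, j)` with `j ≠ 0` give distinct frequencies `j • 1_e` of support size `t`, each of
weight `ρ ^ t` in the noise form; the other frequencies contribute nonnegative terms. -/
theorem sum_labelExcess_edgeSum_le {ρ : ℝ} (hρ : 0 ≤ ρ) {n t : ℕ} (ht : t ≠ 0)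
    (A : Finset (Fin n → ZMod r)) :
    ρ ^ t * ∑ e : {e : Finset (Fin n) // e.card = t}, labelExcess A (edgeSum e.1) ≤
      ∑ x ∈ A, ∑ y ∈ A, ∏ i, (1 - ρ + if x i = y i then ρ * Fintype.card (ZMod r) else 0) := by
  classical
  rw [sum_noise_eq]
  simp_rw [labelExcess_eq]
  let S : Finset ({e : Finset (Fin n) // e.card = t} × ZMod r) :=
    Finset.univ ×ˢ Finset.univ.erase 0
  let emb : {e : Finset (Fin n) // e.card = t} × ZMod r → Fin n → ZMod r :=
    fun p i => if i ∈ p.1.1 then p.2 else 0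
  have hinj : Set.InjOn emb S := by
    rintro ⟨e, j⟩ hp ⟨e', j'⟩ hp' h
    have hj : j ≠ 0 := by simpa [S] using hp
    have hj' : j' ≠ 0 := by simpa [S] using hp'
    have he : e = e' := by
      apply Subtype.ext
      ext i
      have := congrFun h i
      simp only [emb] at this
      split_ifs at this with h1 h2 h2 <;> simp_all
    subst he
    -- A point of `e` is needed to recover `j`; over the empty set every `j` would give the zero
    -- frequency.
    have hne : e.1.Nonempty := by
      rw [← Finset.card_pos, e.2]; omega
    obtain ⟨i, hi⟩ := hne
    have := congrFun h i
    simp only [emb, hi, if_true] at this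
    rw [this]
  rw [Finset.mul_sum]
  calc _ = ∑ p ∈ S, (∏ i, if emb p i = 0 then 1 else ρ) *
        Complex.normSq (∑ x ∈ A, ZMod.stdAddChar (∑ i, emb p i * x i)) := by
        rw [Finset.sum_product]
        refine Finset.sum_congr rfl fun e _ => ?_
        rw [Finset.mul_sum]
        refine Finset.sum_congr rfl fun j hj => ?_
        have hj : j ≠ 0 := by simpa using hj
        congr 1
        · have : ∀ i, (if emb (e, j) i = 0 then 1 else ρ) = if i ∈ e.1 then ρ else 1 := fun i => by
            simp only [emb]
            split_ifs <;> simp_all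
          simp_rw [this, Finset.prod_ite_mem, Finset.univ_inter, Finset.prod_const, e.2]
        · simp [emb, edgeSum, Finset.mul_sum, ite_mul, Finset.sum_ite_mem]
    _ = ∑ k ∈ S.image emb, (∏ i, if k i = 0 then 1 else ρ) *
        Complex.normSq (∑ x ∈ A, ZMod.stdAddChar (∑ i, k i * x i)) :=
        by rw [Finset.sum_image hinj]
    _ ≤ _ := Finset.sum_le_sum_of_subset_of_nonneg (Finset.subset_univ _) fun k _ _ =>
        mul_nonneg (Finset.prod_nonneg fun i _ => by split_ifs <;> linarith)
          (Complex.normSq_nonneg _)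

end Fourier

/-- How much the memory `mem` tells about the label `lab` of a uniformly random `x`: the average
over `x` of the `χ²`-divergence of the label given the memory from the uniform distribution. -/
noncomputable def leakage {r : ℕ} [NeZero r] {X M : Type*} [Fintype X] [Fintype M] [DecidableEq M]
    (mem : X → M) (lab : X → ZMod r) : ℝ :=
  (Fintype.card X : ℝ)⁻¹ * ∑ m, ((Finset.univ.filter fun x => mem x = m).card : ℝ)⁻¹ *
    labelExcess (Finset.univ.filter fun x => mem x = m) lab

/-- Jensen for the concave power `β`, by Bernoulli's inequality around the mean of `N`. -/
theorem sum_rpow_le_card_rpow {M : Type*} [Fintype M] {N : M → ℝ} (hN : ∀ m, 0 ≤ N m) {β : ℝ} (hβ : 0 ≤ β) (hβ1 : β ≤ 1)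
    (hS : 0 < ∑ m, N m) :
    ∑ m, N m ^ β ≤ (Fintype.card M : ℝ) ^ (1 - β) * (∑ m, N m) ^ β := by
  set S := ∑ m, N m
  have hM : Nonempty M := by
    by_contra h
    rw [not_nonempty_iff] at h
    simp [S] at hS
  have hc : (0 : ℝ) < Fintype.card M := by exact_mod_cast Fintype.card_pos
  set c : ℝ := (Fintype.card M : ℝ) with hcdef
  have hpt : ∀ m, N m ^ β ≤ (S / c) ^ β * (1 + β * (c * N m / S - 1)) := fun m => by
    have h1 : N m = S / c * (1 + (c * N m / S - 1)) := by field_simp; ring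
    conv_lhs => rw [h1]
    have h2 : 0 ≤ c * N m / S := by have := hN m; positivity
    rw [Real.mul_rpow (by positivity) (by linarith)]
    exact mul_le_mul_of_nonneg_left
      (rpow_one_add_le_one_add_mul_self (by linarith) hβ hβ1) (by positivity)
  refine (Finset.sum_le_sum fun m _ => hpt m).trans (le_of_eq ?_)
  have h3 : ∀ m, (1 + β * (c * N m / S - 1)) = (1 - β) * 1 + β * c / S * N m := fun m => by ring
  rw [← Finset.mul_sum]
  simp_rw [h3]
  rw [Finset.sum_add_distrib, ← Finset.mul_sum, ← Finset.mul_sum]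
  have h4 : ∑ _m : M, (1 : ℝ) = c := by simp [c]
  rw [h4, Real.rpow_sub hc, Real.rpow_one, Real.div_rpow hS.le hc.le]
  field_simp
  ring

/-! ### Leakage of the memory about the edge sums -/

section Leakage

variable {r : ℕ} [NeZero r] {X M : Type*} [Fintype X] [Fintype M] [DecidableEq M]

theorem leakage_nonneg (mem : X → M) (lab : X → ZMod r) : 0 ≤ leakage mem lab :=
  mul_nonneg (by positivity) (Finset.sum_nonneg fun _ _ =>
    mul_nonneg (by positivity) (labelExcess_nonneg _ _))

/-- Hypercontractivity bounds the contribution of a fibre of size `N` by a constant times `N ^ (2 /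
p)`, where `p = 1 + δ`. Division by `N` leaves a concave power, so fibres of equal size are the
worst case; the powers of `r ^ n` cancel and `|M| ^ (2 - 2 / p)` remains. -/
theorem sum_leakage_edgeSum_le {n t : ℕ} (ht : t ≠ 0) {δ : ℝ} (hδ : 0 < δ) (hδ1 : δ ≤ 1)
    (mem : (Fin n → ZMod r) → M) :
    ∑ e : {e : Finset (Fin n) // e.card = t}, leakage mem (edgeSum e.1) ≤
      (4 * r / δ) ^ t * (Fintype.card M : ℝ) ^ (2 * δ) := by
  have hr : (0 : ℝ) < r := by exact_mod_cast Nat.pos_of_ne_zero (NeZero.ne r)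
  set p := 1 + δ with hp
  set ρ : ℝ := δ / (4 * Fintype.card (ZMod r)) with hρ
  have hρ' : ρ = δ / (4 * r) := by rw [hρ, ZMod.card]
  have hρ0 : 0 < ρ := by rw [hρ']; positivity
  have hM : Nonempty M := ⟨mem 0⟩
  have hM1 : (1 : ℝ) ≤ Fintype.card M := by exact_mod_cast Fintype.card_pos
  let N : M → ℝ := fun m => ((Finset.univ.filter fun x => mem x = m).card : ℝ)
  have hX : (Fintype.card (Fin n → ZMod r) : ℝ) = (r : ℝ) ^ n := by simp [ZMod.card]
  have hNsum : ∑ m, N m = (r : ℝ) ^ n := by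
    rw [← hX, ← Finset.card_univ, Finset.card_eq_sum_card_fiberwise
      (f := mem) (t := Finset.univ) (fun _ _ => Finset.mem_coe.2 (Finset.mem_univ _))]
    push_cast
    rfl
  have hfiber : ∀ m, ∑ e : {e : Finset (Fin n) // e.card = t},
      labelExcess (Finset.univ.filter fun x => mem x = m) (edgeSum e.1) ≤
        (ρ ^ t)⁻¹ * (((r : ℝ) ^ (2 - 2 / p)) ^ n * N m ^ (2 / p)) := fun m => by
    rw [le_inv_mul_iff₀ (by positivity)]
    have h1 := sum_labelExcess_edgeSum_le hρ0.le ht (Finset.univ.filter fun x => mem x = m)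
    have h2 := noise_finset_le hδ.le hδ1 hρ (Finset.univ.filter fun x => mem x = m)
    rw [ZMod.card] at h2
    refine h1.trans (le_trans (le_of_eq ?_) h2)
    rw [ZMod.card]
  have hβ : 0 ≤ 2 / p - 1 := by
    rw [sub_nonneg, le_div_iff₀ (by linarith)]; linarith
  have hβ1 : 2 / p - 1 ≤ 1 := by
    rw [sub_le_iff_le_add, div_le_iff₀ (by linarith)]; linarith
  have hNN : ∀ m, (N m)⁻¹ * N m ^ (2 / p) ≤ N m ^ (2 / p - 1) := fun m => by
    have hNm : 0 ≤ N m := Nat.cast_nonneg _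
    rcases hNm.eq_or_lt with h | h
    · rw [← h, inv_zero, zero_mul]; exact Real.rpow_nonneg le_rfl _
    · rw [Real.rpow_sub h, Real.rpow_one, inv_mul_eq_div]
  have hpow := sum_rpow_le_card_rpow (N := N) (fun m => Nat.cast_nonneg _) hβ hβ1
    (by rw [hNsum]; positivity)
  rw [hNsum] at hpow
  simp only [leakage]
  rw [← Finset.mul_sum, Finset.sum_comm, hX]
  calc _ ≤ ((r : ℝ) ^ n)⁻¹ * ∑ m, (N m)⁻¹ *
        ((ρ ^ t)⁻¹ * (((r : ℝ) ^ (2 - 2 / p)) ^ n * N m ^ (2 / p))) := by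
        refine mul_le_mul_of_nonneg_left (Finset.sum_le_sum fun m _ => ?_) (by positivity)
        rw [← Finset.mul_sum]
        exact mul_le_mul_of_nonneg_left (hfiber m) (by positivity)
    _ = ((r : ℝ) ^ n)⁻¹ * ((ρ ^ t)⁻¹ * ((r : ℝ) ^ (2 - 2 / p)) ^ n) *
        ∑ m, (N m)⁻¹ * N m ^ (2 / p) := by
        rw [mul_assoc, Finset.mul_sum (a := _ * _ ^ n)]
        congr 1
        exact Finset.sum_congr rfl fun m _ => by ring
    _ ≤ ((r : ℝ) ^ n)⁻¹ * ((ρ ^ t)⁻¹ * ((r : ℝ) ^ (2 - 2 / p)) ^ n) *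
        ((Fintype.card M : ℝ) ^ (1 - (2 / p - 1)) * ((r : ℝ) ^ n) ^ (2 / p - 1)) :=
        mul_le_mul_of_nonneg_left
          ((Finset.sum_le_sum fun m _ => hNN m).trans hpow) (by positivity)
    _ = (4 * r / δ) ^ t * (Fintype.card M : ℝ) ^ (1 - (2 / p - 1)) := by
        have h1 : ((r : ℝ) ^ n)⁻¹ * (((r : ℝ) ^ (2 - 2 / p)) ^ n * ((r : ℝ) ^ n) ^ (2 / p - 1)) =
            1 := by
          have hrn : (0 : ℝ) < (r : ℝ) ^ n := by positivity
          have h2 : ((r : ℝ) ^ (2 - 2 / p)) ^ n = ((r : ℝ) ^ n) ^ (2 - 2 / p) := by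
            rw [← Real.rpow_natCast, ← Real.rpow_natCast, ← Real.rpow_mul hr.le,
              ← Real.rpow_mul hr.le, mul_comm]
          rw [h2, ← Real.rpow_add hrn]
          have h3 : 2 - 2 / p + (2 / p - 1) = 1 := by ring
          rw [h3, Real.rpow_one, inv_mul_cancel₀ hrn.ne']
        have h4 : (ρ ^ t)⁻¹ = (4 * r / δ) ^ t := by
          rw [hρ', ← inv_pow, inv_div]
        rw [h4]
        linear_combination (4 * r / δ) ^ t * (Fintype.card M : ℝ) ^ (1 - (2 / p - 1)) * h1
    _ ≤ _ := by
        refine mul_le_mul_of_nonneg_left (Real.rpow_le_rpow_of_exponent_le hM1 ?_) (by positivity)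
        have : 2 - 2 * δ ≤ 2 / p := by
          rw [le_div_iff₀ (by linarith)]; nlinarith
        linarith

/-- Since `h m` has mean zero, only the deviation of the label counts from uniform matters on each
fibre. Young's inequality with weight `a` separates it from `h`, and its squares add up to the label
excess divided by `r`. The second term is an average over uniform labels, not over the true ones. -/
theorem average_le_leakage (mem : X → M) (lab : X → ZMod r) (h : M → ZMod r → ℝ)
    (hh : ∀ m, ∑ b, h m b = 0) {a : ℝ} (ha : 0 < a) :
    (Fintype.card X : ℝ)⁻¹ * ∑ x, h (mem x) (lab x) ≤ a * leakage mem lab +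
      (4 * a)⁻¹ * ((Fintype.card X : ℝ)⁻¹ * ∑ x, (r : ℝ)⁻¹ * ∑ b, h (mem x) b ^ 2) := by
  have hr : (0 : ℝ) < r := by exact_mod_cast Nat.pos_of_ne_zero (NeZero.ne r)
  have hfib : ∀ f : M → X → ℝ, ∑ x, f (mem x) x =
      ∑ m, ∑ x ∈ Finset.univ.filter (fun x => mem x = m), f m x := fun f => by
    rw [← Finset.sum_fiberwise_of_maps_to (g := mem) (t := Finset.univ)
      (fun _ _ => Finset.mem_univ _)]
    refine Finset.sum_congr rfl fun m _ => Finset.sum_congr rfl fun x hx => ?_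
    rw [(Finset.mem_filter.1 hx).2]
  have key : ∀ m, ∑ x ∈ Finset.univ.filter (fun x => mem x = m), h m (lab x) ≤
      a * (((Finset.univ.filter fun x => mem x = m).card : ℝ)⁻¹ *
        labelExcess (Finset.univ.filter fun x => mem x = m) lab) +
      (4 * a)⁻¹ * ∑ x ∈ Finset.univ.filter (fun x => mem x = m), (r : ℝ)⁻¹ * ∑ b, h m b ^ 2 := by
    intro m
    set A := Finset.univ.filter fun x => mem x = m
    rcases A.eq_empty_or_nonempty with hA | hA
    · simp [hA]
    have hN : (0 : ℝ) < A.card := by exact_mod_cast hA.card_pos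
    let Nb : ZMod r → ℝ := fun b => ((A.filter fun x => lab x = b).card : ℝ)
    have hNb : ∑ b, Nb b = A.card := by
      rw [Finset.card_eq_sum_card_fiberwise (f := lab) (t := Finset.univ)
        (fun _ _ => Finset.mem_coe.2 (Finset.mem_univ _))]
      push_cast
      rfl
    have h1 : ∑ x ∈ A, h m (lab x) = ∑ b, Nb b * h m b := by
      rw [← Finset.sum_fiberwise_of_maps_to (g := lab) (t := Finset.univ)
        (fun _ _ => Finset.mem_univ _)]
      refine Finset.sum_congr rfl fun b _ => ?_
      rw [Finset.sum_congr rfl fun x hx => by rw [(Finset.mem_filter.1 hx).2],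
        Finset.sum_const, nsmul_eq_mul]
    set N : ℝ := (A.card : ℝ)
    have h2 : ∑ b, Nb b * h m b = ∑ b, (Nb b - N / r) * h m b := by
      simp_rw [sub_mul, Finset.sum_sub_distrib, ← Finset.mul_sum, hh m]; simp
    have h3 : ∀ b, (Nb b - N / r) * h m b ≤
        a * r / N * (Nb b - N / r) ^ 2 + N / (4 * a * r) * h m b ^ 2 := fun b => by
      have := sq_nonneg (2 * a * r * (Nb b - N / r) - N * h m b)
      have h4 : a * r / N * (Nb b - N / r) ^ 2 + N / (4 * a * r) * h m b ^ 2 -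
          (Nb b - N / r) * h m b =
          (2 * a * r * (Nb b - N / r) - N * h m b) ^ 2 / (4 * a * r * N) := by
        generalize Nb b - N / r = z
        field_simp; ring
      have : 0 ≤ (2 * a * r * (Nb b - N / r) - N * h m b) ^ 2 / (4 * a * r * N) := by positivity
      linarith
    have h5 : ∑ b, (Nb b - N / r) ^ 2 = (∑ b, Nb b ^ 2) - N ^ 2 / r := by
      have : ∀ b, (Nb b - N / r) ^ 2 = Nb b ^ 2 - 2 * N / r * Nb b + (N / r) ^ 2 * 1 :=
        fun b => by ring
      simp_rw [this]
      rw [Finset.sum_add_distrib, Finset.sum_sub_distrib, ← Finset.mul_sum, ← Finset.mul_sum, hNb]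
      have : ∑ _b : ZMod r, (1 : ℝ) = r := by simp [ZMod.card]
      rw [this]; field_simp; ring
    rw [h1, h2]
    refine (Finset.sum_le_sum fun b _ => h3 b).trans (le_of_eq ?_)
    rw [Finset.sum_add_distrib, ← Finset.mul_sum, ← Finset.mul_sum, h5, Finset.sum_const,
      nsmul_eq_mul, labelExcess]
    change _ = a * (N⁻¹ * (r * ∑ b, Nb b ^ 2 - N ^ 2)) + _ * (N * _)
    field_simp
  rw [hfib fun m x => h m (lab x), hfib fun m _ => (r : ℝ)⁻¹ * ∑ b, h m b ^ 2, leakage]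
  have := mul_le_mul_of_nonneg_left (Finset.sum_le_sum fun m (_ : m ∈ Finset.univ) => key m)
    (by positivity : (0 : ℝ) ≤ (Fintype.card X : ℝ)⁻¹)
  rw [Finset.sum_add_distrib, ← Finset.mul_sum, ← Finset.mul_sum] at this
  refine this.trans (le_of_eq ?_)
  ring

end Leakage

/-! ### From uniform labels to true labels: a martingale argument -/

section Hybrid

variable {r : ℕ} {X M : Type*}

/-- The memory after `i` updates, when the labels are those of `x`. -/
def memAfter (step : ℕ → M → ZMod r → M) (lab : ℕ → X → ZMod r) (m₀ : M) : ℕ → X → M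
  | 0, _ => m₀
  | i + 1, x => step i (memAfter step lab m₀ i x) (lab i x)

/-- The expectation of `acc` after `k` updates with uniformly random labels, when the memory is `m`
before the update with number `i`. -/
noncomputable def uniformValue [NeZero r] (step : ℕ → M → ZMod r → M) (acc : M → ℝ) :
    ℕ → ℕ → M → ℝ
  | 0, _, m => acc m
  | k + 1, i, m => (r : ℝ)⁻¹ * ∑ b, uniformValue step acc k (i + 1) (step i m b)

variable [NeZero r]

theorem uniformValue_mem_Icc (step : ℕ → M → ZMod r → M) {acc : M → ℝ}
    (hacc : ∀ m, acc m ∈ Set.Icc (0 : ℝ) 1) (k i : ℕ) (m : M) :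
    uniformValue step acc k i m ∈ Set.Icc (0 : ℝ) 1 := by
  have hr : (0 : ℝ) < r := by exact_mod_cast Nat.pos_of_ne_zero (NeZero.ne r)
  induction k generalizing i m with
  | zero => exact hacc m
  | succ k ih =>
    refine ⟨mul_nonneg (by positivity) (Finset.sum_nonneg fun b _ => (ih _ _).1), ?_⟩
    rw [uniformValue, inv_mul_le_iff₀ hr]
    refine (Finset.sum_le_sum fun b _ => (ih (i + 1) (step i m b)).2).trans (le_of_eq ?_)
    simp [ZMod.card]

variable [Fintype X] [Nonempty X] [Fintype M] [DecidableEq M]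

/-- Each increment has mean zero under a uniform label, so under the true labels its mean is at most
the leakage plus a small multiple of its uniform-label variance. The same estimate applied to `g ^
2`, which stays in `[0, 1]`, bounds the total variance by `4 * ∑ Q + 2`. -/
theorem average_sub_le_of_martingale (step : ℕ → M → ZMod r → M) (lab : ℕ → X → ZMod r) (m₀ : M)
    (T : ℕ) (g : ℕ → M → ℝ) (hg : ∀ i m, g i m ∈ Set.Icc (0 : ℝ) 1)
    (hstep : ∀ i < T, ∀ m, g i m = (r : ℝ)⁻¹ * ∑ b, g (i + 1) (step i m b)) :
    (Fintype.card X : ℝ)⁻¹ * ∑ x, g T (memAfter step lab m₀ T x) - g 0 m₀ ≤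
      11 * ∑ i ∈ Finset.range T, leakage (memAfter step lab m₀ i) (lab i) + 1 / 20 := by
  have hr : (0 : ℝ) < r := by exact_mod_cast Nat.pos_of_ne_zero (NeZero.ne r)
  have hX : (0 : ℝ) < Fintype.card X := by exact_mod_cast Fintype.card_pos
  have hconst : ∀ z : ℝ, ∑ _b : ZMod r, z = r * z := fun z => by simp [ZMod.card]
  let mem := memAfter step lab m₀
  let E : (X → ℝ) → ℝ := fun f => (Fintype.card X : ℝ)⁻¹ * ∑ x, f x
  have Esub : ∀ f f' : X → ℝ, E (fun x => f x - f' x) = E f - E f' := fun f f' => by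
    simp only [E]; rw [Finset.sum_sub_distrib, mul_sub]
  have Eadd : ∀ f f' : X → ℝ, E (fun x => f x + f' x) = E f + E f' := fun f f' => by
    simp only [E]; rw [Finset.sum_add_distrib, mul_add]
  have Emono : ∀ f f' : X → ℝ, (∀ x, f x ≤ f' x) → E f ≤ E f' := fun f f' h =>
    mul_le_mul_of_nonneg_left (Finset.sum_le_sum fun x _ => h x) (by positivity)
  have Emul : ∀ (c : ℝ) (f : X → ℝ), E (fun x => c * f x) = c * E f := fun c f => by
    simp only [E]; rw [← Finset.mul_sum]; ring
  have Econst : ∀ c : ℝ, E (fun _ => c) = c := fun c => by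
    simp only [E]; rw [Finset.sum_const, nsmul_eq_mul, Finset.card_univ]; field_simp
  let v : ℕ → M → ℝ := fun i m => (r : ℝ)⁻¹ * ∑ b, (g (i + 1) (step i m b) - g i m) ^ 2
  let V : ℕ → ℝ := fun i => E fun x => v i (mem i x)
  let Q : ℕ → ℝ := fun i => leakage (mem i) (lab i)
  have hsum : ∀ i < T, ∀ m, ∑ b, g (i + 1) (step i m b) = r * g i m := fun i hi m => by
    rw [hstep i hi m]; field_simp
  have hsq : ∀ i < T, ∀ m, ∑ b, g (i + 1) (step i m b) ^ 2 = r * (g i m ^ 2 + v i m) := by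
    intro i hi m
    have : ∀ b, (g (i + 1) (step i m b) - g i m) ^ 2 = g (i + 1) (step i m b) ^ 2 -
        2 * g i m * g (i + 1) (step i m b) + g i m ^ 2 := fun b => by ring
    simp only [v, this]
    rw [Finset.sum_add_distrib, Finset.sum_sub_distrib, ← Finset.mul_sum, hsum i hi m, hconst]
    field_simp; ring
  -- The weight 10 gives the variance the coefficient 1/40, so a total variance of `4 * ∑ Q + 2`
  -- costs `∑ Q / 10 + 1 / 20`.
  have hfirst : ∀ i < T, E (fun x => g (i + 1) (mem (i + 1) x)) - E (fun x => g i (mem i x)) ≤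
      10 * Q i + 1 / 40 * V i := by
    intro i hi
    have h := average_le_leakage (mem i) (lab i) (fun m b => g (i + 1) (step i m b) - g i m)
      (fun m => by rw [Finset.sum_sub_distrib, hsum i hi m, hconst, sub_self])
      (a := 10) (by norm_num)
    rw [← Esub]
    refine h.trans (le_of_eq ?_)
    simp only [Q, V, E, v]
    norm_num
  have hsecond : ∀ i < T, V i ≤ 4 * Q i +
      2 * (E (fun x => g (i + 1) (mem (i + 1) x) ^ 2) - E (fun x => g i (mem i x) ^ 2)) := by
    intro i hi
    have h := average_le_leakage (mem i) (lab i)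
      (fun m b => g i m ^ 2 + v i m - g (i + 1) (step i m b) ^ 2)
      (fun m => by rw [Finset.sum_sub_distrib, hsq i hi m, hconst, sub_self])
      (a := 2) (by norm_num)
    -- On `[0, 1]` squaring is 2-Lipschitz, so the increment of `g ^ 2` has variance at most `4 *
    -- v`. With weight 2 only half of `V i` returns on the right, and it can be absorbed.
    have hpt : ∀ m, (r : ℝ)⁻¹ * ∑ b, (g i m ^ 2 + v i m - g (i + 1) (step i m b) ^ 2) ^ 2 ≤
        4 * v i m := fun m => by
      have h1 : ∀ b, (g i m ^ 2 + v i m - g (i + 1) (step i m b) ^ 2) ^ 2 =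
          (g (i + 1) (step i m b) ^ 2 - g i m ^ 2) ^ 2 -
          2 * v i m * g (i + 1) (step i m b) ^ 2 + (2 * v i m * g i m ^ 2 + v i m ^ 2) :=
        fun b => by ring
      have h2 : ∀ b, (g (i + 1) (step i m b) ^ 2 - g i m ^ 2) ^ 2 ≤
          4 * (g (i + 1) (step i m b) - g i m) ^ 2 := fun b => by
        obtain ⟨h3, h4⟩ := hg (i + 1) (step i m b)
        obtain ⟨h5, h6⟩ := hg i m
        have h7 : (g (i + 1) (step i m b) + g i m) ^ 2 ≤ 4 := by nlinarith
        have := mul_le_mul_of_nonneg_right h7 (sq_nonneg (g (i + 1) (step i m b) - g i m))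
        nlinarith
      simp_rw [h1]
      rw [Finset.sum_add_distrib, Finset.sum_sub_distrib, ← Finset.mul_sum, hsq i hi m, hconst]
      have h8 := Finset.sum_le_sum fun b (_ : b ∈ (Finset.univ : Finset (ZMod r))) => h2 b
      rw [← Finset.mul_sum] at h8
      have h9 : ∑ b, (g (i + 1) (step i m b) - g i m) ^ 2 = r * v i m := by
        simp only [v]; field_simp
      rw [h9] at h8
      rw [inv_mul_le_iff₀ hr]
      nlinarith [mul_nonneg hr.le (sq_nonneg (v i m))]
    have h2 := (Emono _ _ fun x => hpt (mem i x)).trans_eq (Emul 4 fun x => v i (mem i x))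
    have h3 : E (fun x => g i (mem i x) ^ 2 + v i (mem i x) - g (i + 1) (mem (i + 1) x) ^ 2) ≤
        2 * Q i + (4 * 2)⁻¹ * E (fun x => (r : ℝ)⁻¹ *
          ∑ b, (g i (mem i x) ^ 2 + v i (mem i x) - g (i + 1) (step i (mem i x) b) ^ 2) ^ 2) := h
    rw [Esub, Eadd] at h3
    change _ ≤ 4 * V i at h2
    change _ + V i - _ ≤ _ at h3
    linarith
  have hA := Finset.sum_le_sum fun i hi => hfirst i (Finset.mem_range.1 hi)
  have hB := Finset.sum_le_sum fun i hi => hsecond i (Finset.mem_range.1 hi)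
  rw [Finset.sum_range_sub (fun i => E fun x => g i (mem i x)), Finset.sum_add_distrib,
    ← Finset.mul_sum, ← Finset.mul_sum] at hA
  rw [Finset.sum_add_distrib, ← Finset.mul_sum (a := (4 : ℝ)), ← Finset.mul_sum (a := (2 : ℝ)),
    Finset.sum_range_sub (fun i => E fun x => g i (mem i x) ^ 2)] at hB
  have h1 : E (fun x => g T (mem T x) ^ 2) ≤ 1 := by
    refine (Emono _ (fun _ => 1) fun x => ?_).trans (Econst 1).le
    have := hg T (mem T x)
    exact pow_le_one₀ this.1 this.2
  have h2 : 0 ≤ E (fun x => g 0 (mem 0 x) ^ 2) :=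
    (Econst 0).ge.trans (Emono (fun _ => 0) _ fun x => sq_nonneg _)
  have h3 : E (fun x => g 0 (mem 0 x)) = g 0 m₀ := Econst (g 0 m₀)
  have h4 : 0 ≤ ∑ i ∈ Finset.range T, Q i := Finset.sum_nonneg fun i _ => leakage_nonneg _ _
  rw [h3] at hA
  change E (fun x => g T (mem T x)) - g 0 m₀ ≤ 11 * ∑ i ∈ Finset.range T, Q i + 1 / 20
  linarith

theorem average_sub_uniformValue_le (step : ℕ → M → ZMod r → M) (lab : ℕ → X → ZMod r) (m₀ : M)
    (T : ℕ) {acc : M → ℝ} (hacc : ∀ m, acc m ∈ Set.Icc (0 : ℝ) 1) :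
    (Fintype.card X : ℝ)⁻¹ * ∑ x, acc (memAfter step lab m₀ T x) -
        uniformValue step acc T 0 m₀ ≤
      11 * ∑ i ∈ Finset.range T, leakage (memAfter step lab m₀ i) (lab i) + 1 / 20 := by
  have h := average_sub_le_of_martingale step lab m₀ T
    (fun i m => uniformValue step acc (T - i) i m)
    (fun i m => uniformValue_mem_Icc step hacc _ _ _) (fun i hi m => by
      have : T - i = (T - (i + 1)) + 1 := by omega
      simp only [this]
      rfl)
  simpa [uniformValue] using h

end Hybrid

/-- Given the values of a random permutation on `p`, its value at `a` is uniform on the rest: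
composing with the transposition of `a` and any `f ∉ p` does not change `F σ`. Here `p` holds the
positions already read. -/
theorem sum_perm_apply_le {α : Type*} [Fintype α] [DecidableEq α] (p : Finset α) {a : α}
    (ha : a ∉ p) (F : Equiv.Perm α → α → ℝ) (hF : ∀ σ e, 0 ≤ F σ e)
    (hp : ∀ σ τ : Equiv.Perm α, (∀ b ∈ p, σ b = τ b) → F σ = F τ) {B : ℝ}
    (hB : ∀ σ, ∑ e, F σ e ≤ B) :
    ((Fintype.card α : ℝ) - p.card) * ∑ σ, F σ (σ a) ≤ Fintype.card (Equiv.Perm α) * B := by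
  have h1 : ∀ f ∈ pᶜ, ∑ σ : Equiv.Perm α, F σ (σ a) = ∑ σ : Equiv.Perm α, F σ (σ f) := by
    intro f hf
    rw [← Equiv.sum_comp (Equiv.mulRight (Equiv.swap a f))]
    refine Finset.sum_congr rfl fun σ _ => ?_
    simp only [Equiv.coe_mulRight, Equiv.Perm.coe_mul, Function.comp_apply, Equiv.swap_apply_left]
    rw [hp (σ * Equiv.swap a f) σ fun b hb => ?_]
    have hba : b ≠ a := fun h => ha (h ▸ hb)
    have hbf : b ≠ f := fun h => Finset.mem_compl.1 hf (h ▸ hb)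
    simp [Equiv.swap_apply_of_ne_of_ne hba hbf]
  have h2 : ((Fintype.card α : ℝ) - p.card) * ∑ σ : Equiv.Perm α, F σ (σ a) =
      ∑ f ∈ pᶜ, ∑ σ : Equiv.Perm α, F σ (σ f) := by
    rw [← Finset.sum_congr rfl h1, Finset.sum_const, nsmul_eq_mul, Finset.card_compl,
      Nat.cast_sub (Finset.card_le_univ p)]
  rw [h2, Finset.sum_comm]
  calc _ ≤ ∑ σ : Equiv.Perm α, B := Finset.sum_le_sum fun σ _ =>
        calc _ ≤ ∑ f, F σ (σ f) :=
              Finset.sum_le_sum_of_subset_of_nonneg (Finset.subset_univ _) fun _ _ _ => hF _ _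
          _ = ∑ f, F σ f := Equiv.sum_comp σ (F σ)
          _ ≤ B := hB σ
    _ = _ := by simp

/-! ### The hard streams and the optimum for random labels -/

section Streams

variable {r t n : ℕ}

/-- The constraint that the sum of the values on `e` is `b`. -/
def sumConstraint (e : {e : Finset (Fin n) // e.card = t}) (b : ZMod r) : UGConstraint r t n :=
  ⟨e.1, e.2, fun _ => 1, b⟩

theorem satisfies_sumConstraint (e : {e : Finset (Fin n) // e.card = t}) (b : ZMod r)
    (x : Fin n → ZMod r) : (sumConstraint e b).Satisfies x ↔ edgeSum e.1 x = b := by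
  unfold UGConstraint.Satisfies edgeSum sumConstraint
  simp only [Units.val_one, one_mul]
  rw [Finset.sum_coe_sort e.1 x]

/-- The stream with the edges `e 0, …, e (T - 1)` and the labels `b`. -/
def sumStream (e : ℕ → {e : Finset (Fin n) // e.card = t}) {T : ℕ} (b : Fin T → ZMod r) :
    UGStream r t n :=
  List.ofFn fun i : Fin T => sumConstraint (e i) (b i)

theorem isSimple_sumStream {e : ℕ → {e : Finset (Fin n) // e.card = t}} {T : ℕ}
    (he : Set.InjOn e (Set.Iio T)) (b : Fin T → ZMod r) : (sumStream e b).IsSimple := by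
  unfold UGStream.IsSimple sumStream
  rw [List.map_ofFn, List.nodup_ofFn]
  intro i j h
  exact Fin.ext (he i.2 j.2 (Subtype.ext h))

theorem opt_sumStream_edgeSum (e : ℕ → {e : Finset (Fin n) // e.card = t}) (T : ℕ)
    (x : Fin n → ZMod r) :
    (sumStream e fun i : Fin T => edgeSum (e i).1 x).opt = T := by
  set L := sumStream e fun i : Fin T => edgeSum (e i).1 x with hL
  have hlen : L.length = T := by simp [hL, sumStream]
  have hx : L.value x = T := by
    unfold UGStream.value
    rw [← hlen, List.countP_eq_length]
    intro C hC
    obtain ⟨i, rfl⟩ := (List.mem_ofFn' _ _).1 hC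
    simpa using (satisfies_sumConstraint _ _ _).2 rfl
  refine le_antisymm ?_ (hx ▸ L.isGreatest_opt.2 ⟨x, rfl⟩)
  obtain ⟨y, hy⟩ := L.isGreatest_opt.1
  rw [← hy, ← hlen]
  exact List.countP_le_length

theorem pow_countP_ofFn {α : Type*} (z : ℝ) {T : ℕ} (f : Fin T → α) (p : α → Bool) :
    z ^ (List.ofFn f).countP p = ∏ i, if p (f i) then z else 1 := by
  induction T with
  | zero => simp
  | succ T ih =>
    rw [List.ofFn_succ, List.countP_cons, Fin.prod_univ_succ, ← ih, pow_add, mul_comm]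
    split_ifs <;> simp

/-- The Chernoff computation: `((r - 1 + z) / r) ^ T` is the exponential moment of the value of a
fixed assignment, and the factor `r ^ n` is the union bound. It suffices that the ratio `q` per
constraint is below 1; a large `C` then beats `r ^ n` with a factor 10 to spare. -/
theorem exists_forall_pow_mul_rpow_le (hr : 0 < r) {γ : ℝ} (hγ : 0 < γ) (hγr : γ < r) :
    ∃ z : ℝ, 1 ≤ z ∧ ∃ C : ℕ, 0 < C ∧ ∀ n : ℕ, 0 < n →
      (r : ℝ) ^ n * (r - 1 + z) ^ (C * n) ≤
        (r : ℝ) ^ (C * n) / 10 * z ^ (((C * n : ℕ) : ℝ) / γ) := by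
  have hr0 : (0 : ℝ) < r := by exact_mod_cast hr
  -- This makes `z = 1 + h` the midpoint of 1 and `r / γ`, so that `z * γ < r`, as the comparison of
  -- `h / r` with `log z / γ` requires.
  set h : ℝ := (r / γ - 1) / 2 with hh
  have h1 : 1 < r / γ := by rwa [lt_div_iff₀ hγ, one_mul]
  have hpos : 0 < h := by rw [hh]; linarith
  set z : ℝ := 1 + h with hz
  have hz0 : 0 < z := by linarith
  set q : ℝ := (r - 1 + z) / (r * z ^ (1 / γ)) with hq
  have hq0 : 0 ≤ q := by
    have : (r : ℝ) - 1 + z = r + h := by rw [hz]; ring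
    rw [hq, this]; positivity
  have hq1 : q < 1 := by
    rw [hq, div_lt_one (by positivity)]
    have h2 : 1 + h / r ≤ Real.exp (h / r) := by linarith [Real.add_one_le_exp (h / r)]
    have h3 : h / z ≤ Real.log z := by
      have := Real.one_sub_inv_le_log_of_pos hz0
      have h4 : 1 - z⁻¹ = h / z := by rw [hz]; field_simp; ring
      linarith
    have h5 : z ^ (1 / γ) = Real.exp (Real.log z / γ) := by
      rw [Real.rpow_def_of_pos hz0]; congr 1; ring
    have h6 : h / r < Real.log z / γ := by
      refine lt_of_lt_of_le ?_ (div_le_div_of_nonneg_right h3 hγ.le)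
      rw [div_div h z γ, div_lt_div_iff₀ hr0 (by positivity)]
      have h7 : z < r / γ := by rw [hz, hh]; linarith
      rw [lt_div_iff₀ hγ] at h7
      exact mul_lt_mul_of_pos_left h7 hpos
    have h8 := h2.trans_lt (Real.exp_lt_exp.2 h6)
    rw [← h5] at h8
    have := mul_lt_mul_of_pos_left h8 hr0
    have h9 : (r : ℝ) * (1 + h / r) = r - 1 + z := by rw [hz]; field_simp; ring
    linarith
  obtain ⟨C, hC⟩ := exists_pow_lt_of_lt_one (by positivity : (0 : ℝ) < 1 / (10 * r)) hq1
  refine ⟨z, by linarith, C + 1, by omega, fun n hn => ?_⟩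
  have hC' : r * q ^ (C + 1) ≤ 1 / 10 := by
    have h2 : q ^ (C + 1) ≤ q ^ C := pow_le_pow_of_le_one hq0 hq1.le (by omega)
    have h3 := mul_le_mul_of_nonneg_left (h2.trans hC.le) hr0.le
    have h4 : (r : ℝ) * (1 / (10 * r)) = 1 / 10 := by field_simp
    linarith
  have h2 : (r * q ^ (C + 1)) ^ n ≤ 1 / 10 :=
    calc _ ≤ (1 / 10 : ℝ) ^ n := pow_le_pow_left₀ (by positivity) hC' n
      _ ≤ (1 / 10 : ℝ) ^ 1 := pow_le_pow_of_le_one (by norm_num) (by norm_num) hn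
      _ = 1 / 10 := pow_one _
  rw [mul_pow, ← pow_mul] at h2
  have h3 : (r : ℝ) - 1 + z = q * (r * z ^ (1 / γ)) := by
    rw [hq]; field_simp
  have h4 : z ^ ((((C + 1) * n : ℕ) : ℝ) / γ) = (z ^ (1 / γ)) ^ ((C + 1) * n) := by
    rw [← Real.rpow_natCast, ← Real.rpow_mul hz0.le]; congr 1; ring
  rw [h3, h4, mul_pow, mul_pow]
  have h5 := mul_le_mul_of_nonneg_right h2
    (by positivity : 0 ≤ (r : ℝ) ^ ((C + 1) * n) * (z ^ (1 / γ)) ^ ((C + 1) * n))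
  linarith

variable [NeZero r]

theorem sum_pow_value_sumStream (z : ℝ) (e : ℕ → {e : Finset (Fin n) // e.card = t}) (T : ℕ)
    (x : Fin n → ZMod r) :
    ∑ b : Fin T → ZMod r, z ^ (sumStream e b).value x = (r - 1 + z) ^ T := by
  unfold UGStream.value sumStream
  simp_rw [pow_countP_ofFn, decide_eq_true_eq, satisfies_sumConstraint]
  rw [← Fintype.prod_sum (fun (i : Fin T) (c : ZMod r) =>
    if edgeSum (e i).1 x = c then z else (1 : ℝ))]
  have : ∀ i : Fin T, ∑ c : ZMod r, (if edgeSum (e i).1 x = c then z else (1 : ℝ)) = r - 1 + z := by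
    intro i
    have h : ∀ c : ZMod r, (if edgeSum (e i).1 x = c then z else (1 : ℝ)) =
        1 + if edgeSum (e i).1 x = c then z - 1 else 0 := fun c => by split_ifs <;> ring
    simp_rw [h, Finset.sum_add_distrib]
    simp [ZMod.card]
    ring
  simp_rw [this]
  simp

/-- Markov's inequality for `z ^ opt`, which is at most the sum of `z ^ value` over all assignments.
-/
theorem card_opt_sumStream_ge_mul_le {z : ℝ} (hz : 1 ≤ z) (θ : ℝ)
    (e : ℕ → {e : Finset (Fin n) // e.card = t}) (T : ℕ) :
    ((Finset.univ.filter fun b : Fin T → ZMod r => θ ≤ (sumStream e b).opt).card : ℝ) * z ^ θ ≤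
      (r : ℝ) ^ n * (r - 1 + z) ^ T := by
  have hz0 : 0 < z := by linarith
  calc _ = ∑ b ∈ Finset.univ.filter (fun b : Fin T → ZMod r => θ ≤ (sumStream e b).opt), z ^ θ := by
        rw [Finset.sum_const, nsmul_eq_mul]
    _ ≤ ∑ b ∈ Finset.univ.filter (fun b : Fin T → ZMod r => θ ≤ (sumStream e b).opt),
        z ^ (sumStream e b).opt := by
        refine Finset.sum_le_sum fun b hb => ?_
        rw [← Real.rpow_natCast]
        exact Real.rpow_le_rpow_of_exponent_le hz (Finset.mem_filter.1 hb).2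
    _ ≤ ∑ b : Fin T → ZMod r, z ^ (sumStream e b).opt :=
        Finset.sum_le_sum_of_subset_of_nonneg (Finset.subset_univ _) fun _ _ _ => by positivity
    _ ≤ ∑ b : Fin T → ZMod r, ∑ x, z ^ (sumStream e b).value x := by
        refine Finset.sum_le_sum fun b _ => ?_
        obtain ⟨y, hy⟩ := (sumStream e b).isGreatest_opt.1
        rw [← hy]
        exact Finset.single_le_sum (f := fun x => z ^ (sumStream e b).value x)
          (fun _ _ => by positivity) (Finset.mem_univ y)
    _ = _ := by
        rw [Finset.sum_comm]
        simp_rw [sum_pow_value_sumStream]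
        simp [ZMod.card]

end Streams

/-! ### Runs of an algorithm on the hard streams -/

namespace StreamingAlgorithm

variable {Ω : Type*} [MeasurableSpace Ω] {α : Type*} {s : ℕ}

theorem measurable_runFrom (A : StreamingAlgorithm Ω α s) (L : List α) (i : ℕ)
    {m : Ω → Fin s → Bool} (hm : Measurable m) : Measurable fun ω => A.runFrom ω i (m ω) L := by
  induction L generalizing i m with
  | nil => exact hm
  | cons a L ih =>
    refine ih (i + 1) (m := fun ω => A.step ω i (m ω) a) ?_
    have h : Measurable fun p : Ω × (Fin s → Bool) => A.step p.1 i p.2 a :=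
      measurable_from_prod_countable_left fun m => A.measurable_step i m a
    exact h.comp (measurable_id.prodMk hm)

theorem measurable_output (A : StreamingAlgorithm Ω α s) (L : List α) :
    Measurable fun ω => A.output ω L := by
  have h : Measurable fun p : Ω × (Fin s → Bool) => A.out p.1 p.2 :=
    measurable_from_prod_countable_left fun m => A.measurable_out m
  exact h.comp (measurable_id.prodMk (A.measurable_runFrom L 0 A.measurable_init))

variable {r t n : ℕ}

theorem runFrom_memAfter {X : Type*} (A : StreamingAlgorithm Ω (UGConstraint r t n) s) (ω : Ω)
    (e : ℕ → {e : Finset (Fin n) // e.card = t}) (lab : ℕ → X → ZMod r) (m₀ : Fin s → Bool)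
    (x : X) (k i : ℕ) :
    A.runFrom ω i (memAfter (fun i m b => A.step ω i m (sumConstraint (e i) b)) lab m₀ i x)
        (sumStream (fun j => e (i + j)) fun j : Fin k => lab (i + j) x) =
      memAfter (fun i m b => A.step ω i m (sumConstraint (e i) b)) lab m₀ (i + k) x := by
  induction k generalizing i with
  | zero => simp [sumStream, runFrom]
  | succ k ih =>
    have h := ih (i + 1)
    unfold sumStream at h ⊢
    rw [List.ofFn_succ, runFrom]
    simp only [Fin.val_zero, Fin.val_succ, add_zero]
    simp only [memAfter, add_assoc, add_comm 1] at h ⊢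
    exact h

theorem uniformValue_eq [NeZero r] (A : StreamingAlgorithm Ω (UGConstraint r t n) s) (ω : Ω)
    (e : ℕ → {e : Finset (Fin n) // e.card = t}) (acc : (Fin s → Bool) → ℝ) (k i : ℕ)
    (m : Fin s → Bool) :
    uniformValue (fun i m b => A.step ω i m (sumConstraint (e i) b)) acc k i m =
      ((r : ℝ) ^ k)⁻¹ * ∑ b : Fin k → ZMod r,
        acc (A.runFrom ω i m (sumStream (fun j => e (i + j)) b)) := by
  induction k generalizing i m with
  | zero => simp [sumStream, runFrom, uniformValue]
  | succ k ih =>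
    rw [uniformValue]
    simp_rw [ih]
    rw [← (Fin.consEquiv fun _ => ZMod r).sum_comp, Fintype.sum_prod_type, ← Finset.mul_sum,
      pow_succ, mul_inv, ← mul_assoc, mul_comm ((r : ℝ)⁻¹)]
    congr 1
    refine Finset.sum_congr rfl fun c _ => Finset.sum_congr rfl fun b _ => ?_
    unfold sumStream
    rw [List.ofFn_succ (n := k), runFrom]
    simp [Fin.consEquiv, add_assoc, add_comm 1]

end StreamingAlgorithm

/-- The memory before step `i` depends only on the hyperedges at earlier positions, so the next one
is uniform over at least half of all `t`-sets. The averaged leakage of a step is then at most `2 * B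
/ n.choose t`, and the martingale estimate adds up the `T` steps. -/
theorem sum_perm_average_sub_uniformValue_le {r : ℕ} [NeZero r] {n t : ℕ} (ht : t ≠ 0)
    {M : Type*} [Fintype M] [DecidableEq M]
    (next : ℕ → M → {e : Finset (Fin n) // e.card = t} → ZMod r → M) (m₀ : M)
    {acc : M → ℝ} (hacc : ∀ m, acc m ∈ Set.Icc (0 : ℝ) 1) {T : ℕ}
    (l : ℕ → {e : Finset (Fin n) // e.card = t}) (hl : Set.InjOn l (Set.Iio T))
    (hT : 0 < T) (hTn : 2 * T ≤ n.choose t) {δ : ℝ} (hδ : 0 < δ) (hδ1 : δ ≤ 1) :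
    ∑ σ : Equiv.Perm {e : Finset (Fin n) // e.card = t},
      ((Fintype.card (Fin n → ZMod r) : ℝ)⁻¹ * ∑ x, acc (memAfter
          (fun i m b => next i m (σ (l i)) b) (fun i => edgeSum (σ (l i)).1) m₀ T x) -
        uniformValue (fun i m b => next i m (σ (l i)) b) acc T 0 m₀) ≤
      Fintype.card (Equiv.Perm {e : Finset (Fin n) // e.card = t}) *
        (11 * (2 * T * ((4 * r / δ) ^ t * (Fintype.card M : ℝ) ^ (2 * δ)) / n.choose t) +
          1 / 20) := by
  set B : ℝ := (4 * r / δ) ^ t * (Fintype.card M : ℝ) ^ (2 * δ) with hB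
  have hB0 : 0 ≤ B := by positivity
  set P : ℝ := (Fintype.card (Equiv.Perm {e : Finset (Fin n) // e.card = t}) : ℝ)
  have hcard : Fintype.card {e : Finset (Fin n) // e.card = t} = n.choose t := by simp
  have hN : (0 : ℝ) < n.choose t := by
    have : 0 < n.choose t := by omega
    exact_mod_cast this
  have hmem : ∀ (i : ℕ) (σ τ : Equiv.Perm {e : Finset (Fin n) // e.card = t}),
      (∀ j < i, σ (l j) = τ (l j)) →
      memAfter (fun i m b => next i m (σ (l i)) b) (fun i => edgeSum (r := r) (σ (l i)).1) m₀ i =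
        memAfter (fun i m b => next i m (τ (l i)) b) (fun i => edgeSum (τ (l i)).1) m₀ i := by
    intro i σ τ
    induction i with
    | zero => intro _; rfl
    | succ i ih =>
      intro h
      funext x
      simp only [memAfter]
      rw [ih fun j hj => h j (by omega), h i (by omega)]
  have hone : ∀ i < T, ∑ σ : Equiv.Perm {e : Finset (Fin n) // e.card = t},
      leakage (memAfter (fun i m b => next i m (σ (l i)) b) (fun i => edgeSum (r := r) (σ (l i)).1)
        m₀ i) (edgeSum (σ (l i)).1) ≤ P * (2 * B / n.choose t) := by
    intro i hi
    have h := sum_perm_apply_le ((Finset.range i).image l) (a := l i)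
      (fun h => by
        obtain ⟨j, hj, hji⟩ := Finset.mem_image.1 h
        have hj := Finset.mem_range.1 hj
        have := hl (Set.mem_Iio.2 (hj.trans hi)) (Set.mem_Iio.2 hi) hji
        omega)
      (fun σ e => leakage (memAfter (fun i m b => next i m (σ (l i)) b)
        (fun i => edgeSum (r := r) (σ (l i)).1) m₀ i) (edgeSum e.1))
      (fun σ e => leakage_nonneg _ _)
      (fun σ τ h => by
        rw [hmem i σ τ fun j hj => h _ (Finset.mem_image_of_mem _ (Finset.mem_range.2 hj))])
      (fun σ => sum_leakage_edgeSum_le ht hδ hδ1 _)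
    rw [hcard] at h
    have h1 : (((Finset.range i).image l).card : ℝ) ≤ n.choose t / 2 := by
      have h2 : ((Finset.range i).image l).card ≤ i := by
        simpa using Finset.card_image_le (s := Finset.range i) (f := l)
      have h3 : 2 * ((Finset.range i).image l).card ≤ n.choose t := by omega
      have : (2 : ℝ) * (((Finset.range i).image l).card : ℝ) ≤ n.choose t := by exact_mod_cast h3
      linarith
    have h0 : 0 ≤ ∑ σ : Equiv.Perm {e : Finset (Fin n) // e.card = t},
        leakage (memAfter (fun i m b => next i m (σ (l i)) b)
          (fun i => edgeSum (r := r) (σ (l i)).1) m₀ i) (edgeSum (σ (l i)).1) :=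
      Finset.sum_nonneg fun _ _ => leakage_nonneg _ _
    have h4 : P * (2 * B / n.choose t) = P * B / (n.choose t / 2) := by field_simp
    rw [h4, le_div_iff₀ (by positivity)]
    refine le_trans ?_ h
    rw [mul_comm]
    exact mul_le_mul_of_nonneg_right (by linarith) h0
  calc _ ≤ ∑ σ : Equiv.Perm {e : Finset (Fin n) // e.card = t},
        (11 * ∑ i ∈ Finset.range T, leakage (memAfter (fun i m b => next i m (σ (l i)) b)
          (fun i => edgeSum (r := r) (σ (l i)).1) m₀ i) (edgeSum (σ (l i)).1) + 1 / 20) :=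
        Finset.sum_le_sum fun σ _ => average_sub_uniformValue_le _ _ m₀ T hacc
    _ = 11 * ∑ i ∈ Finset.range T, ∑ σ : Equiv.Perm {e : Finset (Fin n) // e.card = t},
        leakage (memAfter (fun i m b => next i m (σ (l i)) b)
          (fun i => edgeSum (r := r) (σ (l i)).1) m₀ i) (edgeSum (σ (l i)).1) + P * (1 / 20) := by
        rw [Finset.sum_add_distrib, ← Finset.mul_sum, Finset.sum_comm, Finset.sum_const,
          nsmul_eq_mul, Finset.card_univ]
    _ ≤ 11 * ∑ i ∈ Finset.range T, P * (2 * B / n.choose t) + P * (1 / 20) := by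
        have := Finset.sum_le_sum fun i hi => hone i (Finset.mem_range.1 hi)
        linarith
    _ = _ := by
        rw [Finset.sum_const, nsmul_eq_mul, Finset.card_range]
        ring

theorem div_pow_le_choose {n t : ℕ} (htn : t ≤ n) :
    ((n : ℝ) / t) ^ t ≤ n.choose t := by
  induction t generalizing n with
  | zero => simp
  | succ t ih =>
    obtain ⟨n, rfl⟩ : ∃ k, n = k + 1 := ⟨n - 1, by omega⟩
    have h1 : ((n + 1 : ℕ) : ℝ) * (n.choose t) = (n + 1).choose (t + 1) * ((t + 1 : ℕ) : ℝ) := by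
      exact_mod_cast Nat.add_one_mul_choose_eq n t
    have h2 : (((n + 1).choose (t + 1) : ℕ) : ℝ) =
        ((n + 1 : ℕ) : ℝ) / ((t + 1 : ℕ) : ℝ) * n.choose t := by
      field_simp; linarith
    rw [h2, pow_succ, mul_comm]
    refine mul_le_mul_of_nonneg_left ?_ (by positivity)
    rcases Nat.eq_zero_or_pos t with rfl | ht
    · simp
    refine le_trans (pow_le_pow_left₀ (by positivity) ?_ t) (ih (by omega : t ≤ n))
    rw [div_le_div_iff₀ (by positivity) (by positivity)]
    have : (t : ℝ) ≤ n := by exact_mod_cast (by omega : t ≤ n)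
    push_cast
    nlinarith

theorem sum_mul_measureReal_le {Ω ι : Type*} [MeasurableSpace Ω] [Fintype ι] (μ : Measure Ω)
    [IsProbabilityMeasure μ] {S : ι → Set Ω} (hS : ∀ i, MeasurableSet (S i)) (c : ι → ℝ) {κ : ℝ}
    (h : ∀ ω, ∑ i, c i * (S i).indicator 1 ω ≤ κ) : ∑ i, c i * μ.real (S i) ≤ κ := by
  have hint : ∀ i, Integrable (fun ω => c i * (S i).indicator (1 : Ω → ℝ) ω) μ := fun i =>
    ((integrable_const (1 : ℝ)).indicator (hS i)).const_mul (c i)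
  calc ∑ i, c i * μ.real (S i) = ∫ ω, ∑ i, c i * (S i).indicator (1 : Ω → ℝ) ω ∂μ := by
        rw [integral_finsetSum _ fun i _ => hint i]
        refine Finset.sum_congr rfl fun i _ => ?_
        rw [integral_const_mul, integral_indicator_one (hS i)]
    _ ≤ ∫ _ω, κ ∂μ := integral_mono (integrable_finsetSum _ fun i _ => hint i)
        (integrable_const κ) h
    _ = κ := by simp

/-! ### Consequences of correctness of the algorithm -/

namespace StreamingAlgorithm.ApproximatesUG

variable {Ω : Type*} [MeasurableSpace Ω] {μ : Measure Ω} [IsProbabilityMeasure μ]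
  {r t n s : ℕ} {A : StreamingAlgorithm Ω (UGConstraint r t n) s} {γ : ℝ}

/-- Without memory the output cannot distinguish the empty stream from a single constraint, whose
acceptable intervals are disjoint; two events of probability at least 2/3 would be disjoint. This
settles bounded `n / t`. -/
theorem memory_pos (hA : A.ApproximatesUG μ γ (2 / 3)) (hγ : 0 < γ) (htn : t ≤ n) : 0 < s := by
  by_contra hs
  obtain rfl : s = 0 := by omega
  obtain ⟨e, -, he⟩ := Finset.exists_subset_card_eq
    (s := (Finset.univ : Finset (Fin n))) (n := t) (by simpa using htn)
  let L₀ : UGStream r t n := sumStream (fun _ => ⟨e, he⟩) (fun i : Fin 0 => edgeSum e 0)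
  let L₁ : UGStream r t n := sumStream (fun _ => ⟨e, he⟩) (fun i : Fin 1 => edgeSum e 0)
  have ho₀ : L₀.opt = 0 := opt_sumStream_edgeSum (fun _ => ⟨e, he⟩) 0 0
  have ho₁ : L₁.opt = 1 := opt_sumStream_edgeSum (fun _ => ⟨e, he⟩) 1 0
  have h₀ := hA L₀ (isSimple_sumStream (by intro i hi; simp at hi) _)
  have h₁ := hA L₁ (isSimple_sumStream (by intro i hi j hj _; simp at hi hj; omega) _)
  have hout : ∀ ω, A.output ω L₀ = A.output ω L₁ := fun ω => by
    unfold output; congr 1; exact Subsingleton.elim _ _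
  rw [ho₀] at h₀
  rw [ho₁] at h₁
  simp_rw [hout] at h₀
  have hd : Disjoint {ω | A.output ω L₁ ∈ Set.Icc (((0 : ℕ) : ℝ) / γ) ((0 : ℕ) : ℝ)}
      {ω | A.output ω L₁ ∈ Set.Icc (((1 : ℕ) : ℝ) / γ) ((1 : ℕ) : ℝ)} := by
    rw [Set.disjoint_left]
    rintro ω ⟨-, h1⟩ ⟨h2, -⟩
    have : 0 < ((1 : ℕ) : ℝ) / γ := by positivity
    have h3 := h2.trans h1
    simp only [Nat.cast_zero] at h3
    linarith
  have hu := measureReal_union (μ := μ) hd (A.measurable_output L₁ measurableSet_Icc)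
  have : μ.real ({ω | A.output ω L₁ ∈ Set.Icc (((0 : ℕ) : ℝ) / γ) ((0 : ℕ) : ℝ)} ∪
      {ω | A.output ω L₁ ∈ Set.Icc (((1 : ℕ) : ℝ) / γ) ((1 : ℕ) : ℝ)}) ≤ 1 := measureReal_le_one
  linarith

theorem le_leakage_bound [NeZero r] (hA : A.ApproximatesUG μ γ (2 / 3)) (ht : t ≠ 0) {T : ℕ}
    (hT : 0 < T) (hTn : 2 * T ≤ n.choose t)
    (hopt : ∀ e : ℕ → {e : Finset (Fin n) // e.card = t},
      ((Finset.univ.filter fun b : Fin T → ZMod r => (T : ℝ) / γ ≤ (sumStream e b).opt).card : ℝ) ≤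
        (r : ℝ) ^ T / 10) {δ : ℝ} (hδ : 0 < δ) (hδ1 : δ ≤ 1) :
    11 / 60 ≤ 22 * T * ((4 * r / δ) ^ t * ((2 : ℝ) ^ s) ^ (2 * δ)) / n.choose t := by
  classical
  have hr : (0 : ℝ) < r := by exact_mod_cast Nat.pos_of_ne_zero (NeZero.ne r)
  have hcard : Fintype.card {e : Finset (Fin n) // e.card = t} = n.choose t := by simp
  have : Nonempty {e : Finset (Fin n) // e.card = t} := by
    rw [← Fintype.card_pos_iff, hcard]; omega
  obtain ⟨l, hl⟩ : ∃ l : ℕ → {e : Finset (Fin n) // e.card = t}, Set.InjOn l (Set.Iio T) := by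
    have eq := Fintype.equivFinOfCardEq hcard
    refine ⟨fun i => if h : i < n.choose t then eq.symm ⟨i, h⟩ else Classical.arbitrary _,
      fun i hi j hj h => ?_⟩
    have hi' : i < n.choose t := by have := Set.mem_Iio.1 hi; omega
    have hj' : j < n.choose t := by have := Set.mem_Iio.1 hj; omega
    simpa [hi', hj'] using h
  let e : Equiv.Perm {e : Finset (Fin n) // e.card = t} → ℕ →
    {e : Finset (Fin n) // e.card = t} := fun σ i => σ (l i)
  have he : ∀ σ, Set.InjOn (e σ) (Set.Iio T) := fun σ => σ.injective.comp_injOn hl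
  let S : (ℕ → {e : Finset (Fin n) // e.card = t}) → (Fin T → ZMod r) → Set Ω :=
    fun e b => {ω | (T : ℝ) / γ ≤ A.output ω (sumStream e b)}
  have hS : ∀ e b, MeasurableSet (S e b) := fun e b => A.measurable_output _ measurableSet_Ici
  let y : (ℕ → {e : Finset (Fin n) // e.card = t}) → (Fin n → ZMod r) → Fin T → ZMod r :=
    fun e x i => edgeSum (e i).1 x
  set P : ℝ := (Fintype.card (Equiv.Perm {e : Finset (Fin n) // e.card = t}) : ℝ) with hP
  have hP0 : 0 < P := by rw [hP]; exact_mod_cast Fintype.card_pos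
  set κ : ℝ := 11 * (2 * T * ((4 * r / δ) ^ t * ((2 : ℝ) ^ s) ^ (2 * δ)) / n.choose t) + 1 / 20
    with hκ
  set N : ℝ := (Fintype.card (Fin n → ZMod r) : ℝ) with hN
  have hN0 : 0 < N := by rw [hN]; exact_mod_cast Fintype.card_pos
  -- For fixed `ω` the algorithm is deterministic, and the hybrid estimate bounds its advantage
  -- averaged over `σ`; integration over `ω` comes afterwards.
  have hpt : ∀ ω, ∑ σ, (N⁻¹ * ∑ x, (S (e σ) (y (e σ) x)).indicator (1 : Ω → ℝ) ω -
      ((r : ℝ) ^ T)⁻¹ * ∑ b, (S (e σ) b).indicator (1 : Ω → ℝ) ω) ≤ P * κ := by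
    intro ω
    let acc : (Fin s → Bool) → ℝ := fun m => if (T : ℝ) / γ ≤ A.out ω m then 1 else 0
    have hacc : ∀ m, acc m ∈ Set.Icc (0 : ℝ) 1 := fun m => by
      simp only [acc]; split_ifs <;> simp
    have h := sum_perm_average_sub_uniformValue_le (r := r) ht
      (fun i m e b => A.step ω i m (sumConstraint e b)) (A.init ω) hacc l hl hT hTn hδ hδ1
    have hM : (Fintype.card (Fin s → Bool) : ℝ) = 2 ^ s := by simp
    rw [hM] at h
    refine le_trans (le_of_eq (Finset.sum_congr rfl fun σ _ => ?_)) h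
    have hind : ∀ b, (S (e σ) b).indicator (1 : Ω → ℝ) ω =
        acc (A.runFrom ω 0 (A.init ω) (sumStream (e σ) b)) := fun b => by
      simp only [S, acc, Set.indicator_apply, Set.mem_ofPred_eq, output, Pi.one_apply]
    have h1 := A.uniformValue_eq ω (e σ) acc T 0 (A.init ω)
    have h2 := fun x => A.runFrom_memAfter ω (e σ) (fun i => edgeSum (r := r) (e σ i).1)
      (A.init ω) x T 0
    simp only [zero_add, memAfter] at h1 h2
    simp_rw [hind]
    rw [← h1]
    congr 2
    exact Finset.sum_congr rfl fun x _ => congrArg acc (h2 x)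
  -- Both kinds of streams go into one signed sum, indexed by a disjoint union.
  have hint := sum_mul_measureReal_le μ
    (ι := Equiv.Perm {e : Finset (Fin n) // e.card = t} ×
      ((Fin n → ZMod r) ⊕ (Fin T → ZMod r)))
    (S := fun p => Sum.elim (fun x => S (e p.1) (y (e p.1) x)) (fun b => S (e p.1) b) p.2)
    (by rintro ⟨σ, x | b⟩ <;> exact hS _ _)
    (fun p => Sum.elim (fun _ => N⁻¹) (fun _ => -((r : ℝ) ^ T)⁻¹) p.2) (κ := P * κ)
    (fun ω => by
      refine le_trans (le_of_eq ?_) (hpt ω)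
      simp only [Fintype.sum_prod_type, Fintype.sum_sum_type, Sum.elim_inl, Sum.elim_inr,
        ← Finset.mul_sum, neg_mul, Finset.sum_neg_distrib, sub_eq_add_neg])
  simp only [Fintype.sum_prod_type, Fintype.sum_sum_type, Sum.elim_inl, Sum.elim_inr,
    ← Finset.mul_sum, neg_mul, Finset.sum_neg_distrib] at hint
  have hyes : ∀ σ x, 2 / 3 ≤ μ.real (S (e σ) (y (e σ) x)) := fun σ x => by
    have h := hA (sumStream (e σ) (y (e σ) x)) (isSimple_sumStream (he σ) _)
    have ho : (sumStream (e σ) (y (e σ) x)).opt = T := opt_sumStream_edgeSum (e σ) T x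
    rw [ho] at h
    exact h.trans (measureReal_mono fun ω hω => hω.1)
  have hno : ∀ σ b, μ.real (S (e σ) b) ≤
      1 / 3 + if (T : ℝ) / γ ≤ (sumStream (e σ) b).opt then 1 else 0 := fun σ b => by
    split_ifs with hb
    · have : μ.real (S (e σ) b) ≤ 1 := measureReal_le_one
      linarith
    · have h := hA (sumStream (e σ) b) (isSimple_sumStream (he σ) _)
      have h1 := h.trans (measureReal_mono (s₂ := (S (e σ) b)ᶜ)
        fun ω hω hω' => hb ((show (T : ℝ) / γ ≤ _ from hω').trans hω.2))
      rw [probReal_compl_eq_one_sub (hS _ _)] at h1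
      linarith
  -- True labels are accepted with probability at least 2/3, random ones with probability at most
  -- 1/3 + 1/10 = 13/30. Removing the hybrid loss 1/20 from the gap 7/30 leaves 11/60.
  have hlow : ∑ _σ : Equiv.Perm {e : Finset (Fin n) // e.card = t}, (7 / 30 : ℝ) ≤ P * κ := by
    refine le_trans (Finset.sum_le_sum fun σ _ => ?_) hint
    have h1 : 2 / 3 ≤ N⁻¹ * ∑ x, μ.real (S (e σ) (y (e σ) x)) := by
      rw [le_inv_mul_iff₀ hN0]
      refine le_trans (le_of_eq ?_) (Finset.sum_le_sum fun x _ => hyes σ x)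
      rw [Finset.sum_const, nsmul_eq_mul, Finset.card_univ]
    have h2 : ((r : ℝ) ^ T)⁻¹ * ∑ b, μ.real (S (e σ) b) ≤ 13 / 30 := by
      rw [inv_mul_le_iff₀ (by positivity)]
      refine (Finset.sum_le_sum fun b _ => hno σ b).trans ?_
      rw [Finset.sum_add_distrib, Finset.sum_const, nsmul_eq_mul, Finset.card_univ,
        ← Finset.sum_filter, Finset.sum_const, nsmul_eq_mul]
      have := hopt (e σ)
      have hc : (Fintype.card (Fin T → ZMod r) : ℝ) = (r : ℝ) ^ T := by simp [ZMod.card]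
      rw [hc]
      linarith
    linarith
  rw [Finset.sum_const, nsmul_eq_mul, Finset.card_univ] at hlow
  have hfin := le_of_mul_le_mul_left hlow hP0
  have h22 : 11 * (2 * T * ((4 * r / δ) ^ t * ((2 : ℝ) ^ s) ^ (2 * δ)) / n.choose t) =
      22 * T * ((4 * r / δ) ^ t * ((2 : ℝ) ^ s) ^ (2 * δ)) / n.choose t := by ring
  rw [hκ, h22] at hfin
  linarith

end StreamingAlgorithm.ApproximatesUG

/-! ### Choice of parameters and conclusion -/

theorem two_mul_mul_le_pow {C k : ℝ} (hC : 1 ≤ C) (hk : 4 * C ≤ k) {t : ℕ} (ht : 2 ≤ t) :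
    2 * (C * (k * t)) ≤ k ^ t := by
  induction t, ht using Nat.le_induction with
  | base => push_cast; nlinarith
  | succ t ht ih =>
    have ht' : (2 : ℝ) ≤ t := by exact_mod_cast ht
    have h1 : 2 * (C * (k * t)) * k ≤ k ^ t * k := mul_le_mul_of_nonneg_right ih (by linarith)
    rw [pow_succ]
    refine le_trans ?_ h1
    push_cast
    have h2 : 0 ≤ C * k := by nlinarith
    have h3 : (t : ℝ) + 1 ≤ t * k := by nlinarith
    nlinarith [mul_le_mul_of_nonneg_left h3 h2]

/-- A `t`-th root gives `n ^ (1 - 1 / t) ≤ D * (s + t)`. As `t ^ (1 / t) ≤ 2`, dividing by `t ^ (1 -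
1 / t)` gains a factor of order `t`, and `s + t ≤ 2 * s * t` removes the additive `t`. -/
theorem div_rpow_le_of_pow_le {n t s D : ℝ} {k : ℕ} (hk : (k : ℝ) = t) (ht : 2 ≤ t) (hn : 0 < n)
    (hs : 1 ≤ s) (hD : 0 < D) (h : n ^ k ≤ n * (D * (s + t)) ^ k) :
    (n / t) ^ (1 - 1 / t) ≤ 4 * D * s := by
  have ht0 : 0 < t := by linarith
  have hy : 0 < D * (s + t) := by positivity
  have h1 : n ≤ n ^ (1 / t) * (D * (s + t)) := by
    have h2 := Real.rpow_le_rpow (by positivity) h (by positivity : 0 ≤ 1 / t)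
    have h3 : ∀ {z : ℝ}, 0 < z → (z ^ k) ^ (1 / t) = z := fun {z} hz => by
      rw [← Real.rpow_natCast, ← Real.rpow_mul hz.le, hk, mul_one_div_cancel ht0.ne',
        Real.rpow_one]
    rwa [Real.mul_rpow hn.le (by positivity), h3 hn, h3 hy] at h2
  have h2 : n ^ (1 - 1 / t) ≤ D * (s + t) := by
    rw [Real.rpow_sub hn, Real.rpow_one, div_le_iff₀ (by positivity)]
    linarith
  have h3 : t ^ (1 / t) ≤ 2 := by
    have h4 : t ≤ (2 : ℝ) ^ t := by
      rw [← hk, Real.rpow_natCast]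
      exact_mod_cast Nat.lt_two_pow_self.le
    calc _ ≤ ((2 : ℝ) ^ t) ^ (1 / t) := Real.rpow_le_rpow ht0.le h4 (by positivity)
      _ = 2 := by rw [← Real.rpow_mul (by norm_num), mul_one_div_cancel ht0.ne', Real.rpow_one]
  have h4 : t / 2 ≤ t ^ (1 - 1 / t) := by
    rw [Real.rpow_sub ht0, Real.rpow_one]
    exact div_le_div_of_nonneg_left ht0.le (by positivity) h3
  rw [Real.div_rpow hn.le ht0.le, div_le_iff₀ (by positivity)]
  refine h2.trans (le_trans ?_ (mul_le_mul_of_nonneg_left h4 (by positivity)))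
  nlinarith [mul_nonneg hD.le (mul_nonneg (by linarith : 0 ≤ s - 1) (by linarith : 0 ≤ t - 1))]

theorem mainTheorem7 (r : ℕ) (hr : 2 ≤ r) (ε : ℝ) (hε : 0 < ε) (hεr : ε < r) :
    ∃ c : ℝ, 0 < c ∧
      ∀ (t n : ℕ), 2 ≤ t → t ≤ n →
        ∀ (Ω : Type*) [MeasurableSpace Ω] (μ : Measure Ω) [IsProbabilityMeasure μ] (s : ℕ)
          (A : StreamingAlgorithm Ω (UGConstraint r t n) s),
          A.ApproximatesUG μ ((r : ℝ) - ε) (2 / 3) →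
            c * ((n : ℝ) / (t : ℝ)) ^ (1 - 1 / (t : ℝ)) ≤ (s : ℝ) := by
  have hr0 : 0 < r := by omega
  have : NeZero r := ⟨hr0.ne'⟩
  have hrR : (0 : ℝ) < r := by exact_mod_cast hr0
  have hγ : 0 < (r : ℝ) - ε := by linarith
  obtain ⟨z, hz, C, hC, hzC⟩ := exists_forall_pow_mul_rpow_le hr0 hγ (by linarith)
  have hC1 : (1 : ℝ) ≤ C := by exact_mod_cast hC
  -- The 120 is `22 / (11 / 60)`; `16 * r` is the `4 * r` of the leakage bound times the 4 from the
  -- memory factor.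
  set D : ℝ := 120 * C * (16 * r) with hD
  have hD0 : 0 < D := by positivity
  refine ⟨min (1 / (4 * C)) (1 / (4 * D)), by positivity, ?_⟩
  intro t n ht htn Ω _ μ _ s A hA
  have ht2 : (2 : ℝ) ≤ t := by exact_mod_cast ht
  have ht0 : (0 : ℝ) < t := by linarith
  have htnR : (t : ℝ) ≤ n := by exact_mod_cast htn
  have hn0 : (0 : ℝ) < n := by linarith
  have hs : (1 : ℝ) ≤ s := by exact_mod_cast hA.memory_pos hγ htn
  have hk1 : 1 ≤ (n : ℝ) / t := by rwa [le_div_iff₀ ht0, one_mul]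
  have hpow0 : 0 ≤ ((n : ℝ) / t) ^ (1 - 1 / (t : ℝ)) := by positivity
  -- For small `n / t` the bound follows from `s ≥ 1`. Otherwise `C * n` is at most half the number
  -- of `t`-sets, so the hard stream can have distinct hyperedges.
  rcases lt_or_ge ((n : ℝ) / t) (4 * C) with hsmall | hbig
  · have h1 : ((n : ℝ) / t) ^ (1 - 1 / (t : ℝ)) ≤ (n : ℝ) / t := by
      conv_rhs => rw [← Real.rpow_one ((n : ℝ) / t)]
      refine Real.rpow_le_rpow_of_exponent_le hk1 ?_
      have : 0 ≤ 1 / (t : ℝ) := by positivity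
      linarith
    calc _ ≤ 1 / (4 * C) * (4 * (C : ℝ)) :=
          mul_le_mul (min_le_left _ _) (h1.trans hsmall.le) hpow0 (by positivity)
      _ = 1 := by field_simp
      _ ≤ s := hs
  · have hchoose := div_pow_le_choose htn
    have hTn : 2 * (C * n) ≤ n.choose t := by
      have h1 := two_mul_mul_le_pow hC1 hbig ht
      rw [div_mul_cancel₀ _ ht0.ne'] at h1
      exact_mod_cast h1.trans hchoose
    have hopt : ∀ e : ℕ → {e : Finset (Fin n) // e.card = t},
        ((Finset.univ.filter fun b : Fin (C * n) → ZMod r =>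
          ((C * n : ℕ) : ℝ) / ((r : ℝ) - ε) ≤ (sumStream e b).opt).card : ℝ) ≤
            (r : ℝ) ^ (C * n) / 10 := fun e =>
      le_of_mul_le_mul_right ((card_opt_sumStream_ge_mul_le hz _ e (C * n)).trans
        (hzC n (by omega))) (by positivity)
    -- This balances `(1 / δ) ^ t` against `2 ^ (2 * δ * s)`: the choice `t / s`, modified to stay
    -- at most 1.
    set δ : ℝ := t / (s + t) with hδ
    have hδ0 : 0 < δ := by positivity
    have hδ1 : δ ≤ 1 := by rw [hδ, div_le_one (by positivity)]; linarith
    have hmain := hA.le_leakage_bound (by omega) (Nat.mul_pos hC (by omega)) hTn hopt hδ0 hδ1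
    have hmem : ((2 : ℝ) ^ s) ^ (2 * δ) ≤ 4 ^ t := by
      have h4 : (4 : ℝ) ^ t = 2 ^ (2 * (t : ℝ)) := by
        rw [Real.rpow_mul (by norm_num), Real.rpow_natCast]; norm_num
      rw [h4, ← Real.rpow_natCast, ← Real.rpow_mul (by norm_num)]
      refine Real.rpow_le_rpow_of_exponent_le (by norm_num) ?_
      have : s * δ ≤ t := by
        rw [hδ, mul_div_assoc', div_le_iff₀ (by positivity)]
        nlinarith
      linarith
    have hB : (4 * r / δ) ^ t * ((2 : ℝ) ^ s) ^ (2 * δ) / n.choose t ≤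
        (16 * r * (s + t) / n) ^ t := by
      calc _ ≤ (4 * r / δ) ^ t * 4 ^ t / ((n : ℝ) / t) ^ t :=
            div_le_div₀ (by positivity) (mul_le_mul_of_nonneg_left hmem (by positivity))
              (by positivity) hchoose
        _ = _ := by
            rw [← mul_pow, ← div_pow, hδ]
            congr 1
            field_simp
            ring
    have h1 : (1 : ℝ) ≤ 120 * C * n * (16 * r * (s + t) / n) ^ t := by
      have h2 := mul_le_mul_of_nonneg_left hB (by positivity : (0 : ℝ) ≤ 22 * (C * n))
      have h3 : 22 * ((C * n : ℕ) : ℝ) * ((4 * r / δ) ^ t * ((2 : ℝ) ^ s) ^ (2 * δ)) /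
          n.choose t = 22 * (C * n) *
            ((4 * r / δ) ^ t * ((2 : ℝ) ^ s) ^ (2 * δ) / n.choose t) := by push_cast; ring
      rw [h3] at hmain
      linarith
    have h2 : (n : ℝ) ^ t ≤ n * (D * (s + t)) ^ t := by
      have h3 : (120 * C : ℝ) ≤ (120 * C) ^ t := le_self_pow₀ (by linarith) (by omega)
      have h4 : (n : ℝ) * (D * (s + t)) ^ t =
          n ^ t * ((120 * C) ^ t * n * (16 * r * (s + t) / n) ^ t) := by
        rw [hD, div_pow, mul_assoc (120 * (C : ℝ)), mul_pow (120 * (C : ℝ))]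
        field_simp
      rw [h4]
      refine le_mul_of_one_le_right (by positivity) (h1.trans ?_)
      gcongr
    have h3 := div_rpow_le_of_pow_le rfl ht2 hn0 hs hD0 h2
    calc _ ≤ 1 / (4 * D) * (4 * D * s) :=
          mul_le_mul (min_le_right _ _) h3 hpow0 (by positivity)
      _ = s := by field_simp
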